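/- Let $M$ be a smooth Hausdorff $4$-manifold with a smooth Lorentz metric $g$ of signature $(-,+,+,+)$ and Levi-Civita connection $\bar\nabla$. Let $m\in M$, fix a Lorentz-orthonormal basis of $T_mM$, and let $\mathcal O\subseteq T_mM$ be an open neighbourhood of $0$ that $\exp_m$ maps diffeomorphically onto an open neighbourhood $\mathcal U$ of $m$; identify $\mathcal U$ with $\mathcal O$, and carry $g$ and $\bar\nabla$ over to $\mathcal O$. On the manifold $T_mM$ let a smooth connection $\nabla$ (possibly with torsion) be given that is compatible with a smooth positive definite Riemannian metric $h$ on $T_mM$. All norms of tangent vectors are those of $h$. On $\mathcal O$ put $G(X,Y)=\nabla_XY-\bar\nabla_XY$ and $\|G_x\|=\sup_{\|X\|\le 1}\|G_x(X,X)\|$. Let $m_0,m_1\in\mathcal O$, $T>0$, and let $\gamma:[0,T]\to\mathcal O$ be a geodesic of $\nabla$ with $\gamma(0)=m_0$, $\gamma(T)=m_1$, such that $m_0$ and $m_1$ are not conjugate along $\gamma$ (no nontrivial Jacobi field along $\gamma$, i.e. solution of the linearized geodesic equation, vanishes at both ends) and $\gamma'(0)$ is time-like, $g_{m_0}(\gamma'(0),\gamma'(0))<0$.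 For a continuous curve $v:[0,1]\to T_{m_0}\mathcal O$ let $Sv$ be the $C^1$ curve on $[0,1]$ in $T_mM$, if it exists, with $Sv(0)=m_0$ and with $(Sv)'(t)$ parallel along $Sv$ (for $\nabla$) to $v(t)$ for all $t$; it is unique. For $\varepsilon>0$ let $U_\varepsilon$ be the closed ball of radius $\varepsilon$ about $0$ in $C^0([0,1],T_{m_0}\mathcal O)$. Call $(\varepsilon,C,W,\kappa)$ admissible if $\varepsilon>0$, $W$ is a bounded neighbourhood of $T\gamma'(0)$ (the initial vector of $s\mapsto\gamma(Ts)$), and for every $u\in U_\varepsilon$ the vector $\kappa(u)$ is the unique $a\in W$ with $S(u+a)(1)=m_1$, $\kappa(u)$ depends continuously on $u$, is time-like at $m_0$, and $\|\kappa(u)\|\le C$. (1) For every open set $U\supseteq\gamma([0,T])$ there is an admissible $(\varepsilon,C,W,\kappa)$ such that moreover all the curves $S(u+\kappa(u))$, $u\in U_\varepsilon$, lie in $U$. (2) Let $(\varepsilon,C,W,\kappa)$ be any admissible quadruple. Let $V\subseteq\mathcal O$ be a ball, or more generally any subset, that contains all the curves $S(u+\kappa(u))$, $u\in U_\varepsilon$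 (so in particular $m_0,m_1\in V$), and suppose that $\|G_x\|<\dfrac{\varepsilon}{(\varepsilon+C)^2}$ for all $x\in V$. Then there is a time-like geodesic $c:[0,T]\to M$ of the Levi-Civita connection of $g$ with $c(0)=m_0$ and $c(T)=m_1$. -/

import Mathlib

open Set Filter Topology
open scoped Manifold ContDiff

noncomputable section

/-- The model space `ℝ⁴`, with coordinates `X 0, X 1, X 2, X 3`. -/
abbrev E4 : Type := EuclideanSpace ℝ (Fin 4)

/-- The Minkowski product of signature `(-,+,+,+)`. -/
def minkowski (X Y : E4) : ℝ := -(X 0 * Y 0) + X 1 * Y 1 + X 2 * Y 2 + X 3 * Y 3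

/-! ### Metrics and connections on open subsets of `ℝ⁴` -/

/-- A field of bilinear forms on (an open subset of) `ℝ⁴`. -/
abbrev FormField : Type := E4 → E4 →L[ℝ] E4 →L[ℝ] ℝ

/-- A connection on the manifold `ℝ⁴`, given by its Christoffel map:
`∇_X Y = DY(X) + Γ(X, Y)`; see `covDeriv`. No symmetry in `X, Y` is asked for, so there may be
torsion. -/
abbrev ConnectionField : Type := E4 → E4 →L[ℝ] E4 →L[ℝ] E4

/-- The covariant derivative `(∇_X Y)(x)` of the connection with Christoffel map `Γ`. -/
def covDeriv (Γ : E4 → E4 → E4 → E4) (X Y : E4 → E4) (x : E4) : E4 :=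
  fderiv ℝ Y x (X x) + Γ x (X x) (Y x)

/-- The Koszul functional (Christoffel symbols of the first kind)
`Z ↦ ½ (∂_X g(Y, Z) + ∂_Y g(X, Z) - ∂_Z g(X, Y))` for constant `X, Y, Z`. -/
def koszul (g : FormField) (x X Y : E4) : E4 →L[ℝ] ℝ :=
  (1 / 2 : ℝ) • (fderiv ℝ g x X Y + fderiv ℝ g x Y X - ((fderiv ℝ g x).flip X).flip Y)

/-- The Christoffel map of the Levi-Civita connection of a nondegenerate symmetric `g`:
`g_x (christoffel g x X Y) = koszul g x X Y`. -/
def christoffel (g : FormField) (x X Y : E4) : E4 :=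
  (g x).inverse (koszul g x X Y)

/-- The defining property of the Levi-Civita Christoffel map where the form is nondegenerate. -/
theorem christoffel_spec (g : FormField) (x X Y Z : E4) (hx : (g x).IsInvertible) :
    g x (christoffel g x X Y) Z =
      1 / 2 * (fderiv ℝ g x X Y Z + fderiv ℝ g x Y X Z - fderiv ℝ g x Z X Y) := by
  obtain ⟨e, he⟩ := hx
  have h : g x (christoffel g x X Y) = koszul g x X Y := by
    unfold christoffel
    rw [← he, ContinuousLinearMap.inverse_equiv]
    simp
  rw [h]
  simp [koszul]

/-- A smooth positive definite Riemannian metric on `ℝ⁴`. -/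
structure IsRiemannianMetric (h : FormField) : Prop where
  smooth : ContDiff ℝ ∞ h
  symm : ∀ x X Y, h x X Y = h x Y X
  pos : ∀ x X, X ≠ 0 → 0 < h x X X

/-- The connection `Γ` is compatible with `h`:
`Z h(X, Y) = h(∇_Z X, Y) + h(X, ∇_Z Y)` (written out on constant fields `X, Y, Z`). -/
def IsMetricConnection (Γ : ConnectionField) (h : FormField) : Prop :=
  ∀ x X Y Z, fderiv ℝ h x Z X Y = h x (Γ x Z X) Y + h x X (Γ x Z Y)

/-- The norm of a tangent vector at `x` for the Riemannian metric `h`. -/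
def rnorm (h : FormField) (x X : E4) : ℝ := Real.sqrt (h x X X)

/-- The value `G_x(X, Y)` of the tensor `G(X, Y) = ∇_X Y - ∇̄_X Y`, where `∇` is the connection `Γ`
and `∇̄` is the Levi-Civita connection of `g`; see `gravTensor_eq`. -/
def gravTensor (Γ : ConnectionField) (g : FormField) (x X Y : E4) : E4 :=
  Γ x X Y - christoffel g x X Y

theorem gravTensor_eq (Γ : ConnectionField) (g : FormField) (X Y : E4 → E4) (x : E4) :
    gravTensor Γ g x (X x) (Y x) =
      covDeriv (fun x X Y => Γ x X Y) X Y x - covDeriv (christoffel g) X Y x := by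
  simp [gravTensor, covDeriv]

/-- `‖G_x‖ = sup {‖G_x(X, X)‖ : ‖X‖ ≤ 1}`, with the norms of the Riemannian metric `h`. -/
def gravNorm (Γ : ConnectionField) (g h : FormField) (x : E4) : ℝ :=
  sSup ((fun X => rnorm h x (gravTensor Γ g x X X)) '' {X | rnorm h x X ≤ 1})

/-- At the parameter `t`, relative to the parameter set `J`, the curve `y` has velocity `v` and
satisfies the geodesic equation `y'' + Γ_y(y', y') = 0`. -/
def SolvesGeodesicEq (Γ : E4 → E4 → E4 → E4) (J : Set ℝ) (y v : ℝ → E4) (t : ℝ) : Prop :=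
  HasDerivWithinAt y (v t) J t ∧ HasDerivWithinAt v (-Γ (y t) (v t) (v t)) J t

/-- `γ : [0, T] → ℝ⁴` is a geodesic of the connection `Γ`, with velocity `γ'`. -/
def IsFrameGeodesic (Γ : ConnectionField) (T : ℝ) (γ γ' : ℝ → E4) : Prop :=
  ∀ t ∈ Icc 0 T, SolvesGeodesicEq (fun x X Y => Γ x X Y) (Icc 0 T) γ γ' t

/-- `J`, with derivative `J'`, is a Jacobi field along the geodesic `γ : [0, T] → ℝ⁴`: it solves
the linearization along `γ` of the geodesic equation `γ'' + Γ_γ(γ', γ') = 0`. (For connections with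
torsion too, these are the variation fields of the variations of `γ` through geodesics.) -/
def IsJacobiField (Γ : ConnectionField) (T : ℝ) (γ γ' J J' : ℝ → E4) : Prop :=
  ∀ t ∈ Icc 0 T, HasDerivWithinAt J (J' t) (Icc 0 T) t ∧
    HasDerivWithinAt J'
      (-(fderiv ℝ Γ (γ t) (J t) (γ' t) (γ' t) + Γ (γ t) (J' t) (γ' t) + Γ (γ t) (γ' t) (J' t)))
      (Icc 0 T) t

/-- The endpoints of `γ : [0, T] → ℝ⁴` are not conjugate along `γ`: no nontrivial Jacobi field
along `γ` vanishes at both of them. -/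
def NotConjugateAlong (Γ : ConnectionField) (T : ℝ) (γ γ' : ℝ → E4) : Prop :=
  ∀ J J' : ℝ → E4, IsJacobiField Γ T γ γ' J J' → J 0 = 0 → J T = 0 → ∀ t ∈ Icc 0 T, J t = 0

/-! ### The Cartan development operator -/

/-- `P t` is the parallel translation from `p 0` to `p t` along the curve `p : [0, 1] → ℝ⁴` with
velocity `p'`: for each vector `X`, the field `t ↦ P t X` satisfies `D/dt (P t X) = 0` and starts
at `X`. -/
def IsParallelTranslation (Γ : ConnectionField) (p p' : ℝ → E4) (P : ℝ → E4 →L[ℝ] E4) : Prop :=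
  P 0 = ContinuousLinearMap.id ℝ E4 ∧
    ∀ t ∈ Icc (0 : ℝ) 1, HasDerivWithinAt P (-((Γ (p t) (p' t)).comp (P t))) (Icc 0 1) t

/-- `p = S v` on `[0, 1]`: the `C¹` curve with `p 0 = x₀` whose velocity `p' t` is parallel along
`p` to the vector `v t` of the tangent space at `x₀`. -/
def IsDevelopment (Γ : ConnectionField) (x₀ : E4) (v p : ℝ → E4) : Prop :=
  p 0 = x₀ ∧ ∃ P : ℝ → E4 →L[ℝ] E4,
    (∀ t ∈ Icc (0 : ℝ) 1, HasDerivWithinAt p (P t (v t)) (Icc 0 1) t) ∧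
    IsParallelTranslation Γ p (fun t => P t (v t)) P

/-- The curve `u + a : [0, 1] → T_{x₀}`, for `u ∈ C⁰([0, 1], T_{x₀})` and a constant vector `a`. -/
def shift (u : C(Icc (0 : ℝ) 1, E4)) (a : E4) (t : ℝ) : E4 := u (projIcc 0 1 zero_le_one t) + a

/-- The closed ball `U_ε` of radius `ε` about `0` in `C⁰([0, 1], T_{x₀})`, for the supremum norm
built from the norm of `h` on the tangent space at `x₀`. -/
def curveBall (h : FormField) (x₀ : E4) (ε : ℝ) : Set C(Icc (0 : ℝ) 1, E4) :=
  {u | ∀ t, rnorm h x₀ (u t) ≤ ε}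

/-- `S(u + a)` is defined on `[0, 1]` and `S(u + a)(1) = x₁`. -/
def DevelopsTo (Γ : ConnectionField) (x₀ x₁ : E4) (u : C(Icc (0 : ℝ) 1, E4)) (a : E4) : Prop :=
  ∃ p : ℝ → E4, IsDevelopment Γ x₀ (shift u a) p ∧ p 1 = x₁

/-- The numbers `ε > 0` and `C`, the neighbourhood `W` of the initial vector `X₀` and the map
`u ↦ κ u` are as follows: for each `u ∈ U_ε`, the vector `κ u` is the unique `a ∈ W` with
`S(u + a)(1) = x₁`; it depends continuously on `u`, lies inside the light cone of the Lorentz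
form `g` at `x₀`, and has norm at most `C`. -/
structure IsAdmissible (Γ : ConnectionField) (g h : FormField) (x₀ x₁ X₀ : E4)
    (ε C : ℝ) (W : Set E4) (κ : C(Icc (0 : ℝ) 1, E4) → E4) : Prop where
  eps_pos : 0 < ε
  nhds : W ∈ 𝓝 X₀
  bounded : Bornology.IsBounded W
  mem : ∀ u ∈ curveBall h x₀ ε, κ u ∈ W
  develops : ∀ u ∈ curveBall h x₀ ε, DevelopsTo Γ x₀ x₁ u (κ u)
  unique : ∀ u ∈ curveBall h x₀ ε, ∀ a ∈ W, DevelopsTo Γ x₀ x₁ u a → a = κ u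
  continuousOn : ContinuousOn κ (curveBall h x₀ ε)
  timelike : ∀ u ∈ curveBall h x₀ ε, g x₀ (κ u) (κ u) < 0
  norm_le : ∀ u ∈ curveBall h x₀ ε, rnorm h x₀ (κ u) ≤ C

/-- All the curves `S(u + κ u)`, `u ∈ U_ε`, lie in `V`. -/
def DevelopmentsIn (Γ : ConnectionField) (h : FormField) (x₀ : E4) (ε : ℝ)
    (κ : C(Icc (0 : ℝ) 1, E4) → E4) (V : Set E4) : Prop :=
  ∀ u ∈ curveBall h x₀ ε, ∀ p : ℝ → E4, IsDevelopment Γ x₀ (shift u (κ u)) p →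
    ∀ t ∈ Icc (0 : ℝ) 1, p t ∈ V

/-! ### Lorentz manifolds, their geodesics, and normal charts -/

section Manifold

variable {M : Type*} [TopologicalSpace M] [ChartedSpace E4 M]

/-- The coordinate expression of a field `g` of bilinear forms on `M` in the chart `φ`: the value at
`y` is `(X, Y) ↦ g(dφ⁻¹ X, dφ⁻¹ Y)`. -/
def formInChart
    (g : ∀ x : M, TangentSpace (𝓡 4) x →L[ℝ] TangentSpace (𝓡 4) x →L[ℝ] ℝ)
    (φ : OpenPartialHomeomorph M E4) : FormField := fun y =>
  let D : E4 →L[ℝ] TangentSpace (𝓡 4) (φ.symm y) := mfderiv (𝓡 4) (𝓡 4) φ.symm y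
  (ContinuousLinearMap.precomp ℝ D).comp ((g (φ.symm y)).comp D)

variable (M) in
/-- A smooth Lorentz metric of signature `(-,+,+,+)` on the `4`-manifold `M`. -/
structure LorentzMetric where
  form : ∀ x : M, TangentSpace (𝓡 4) x →L[ℝ] TangentSpace (𝓡 4) x →L[ℝ] ℝ
  /-- Each tangent space has a basis in which the form is the Minkowski product. -/
  lorentz : ∀ x : M, ∃ b : E4 ≃L[ℝ] TangentSpace (𝓡 4) x,
    ∀ X Y, form x (b X) (b Y) = minkowski X Y
  /-- The components of the form are smooth in all charts of the smooth structure. -/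
  smooth : ∀ φ ∈ IsManifold.maximalAtlas (𝓡 4) ∞ M, ContDiffOn ℝ ∞ (formInChart form φ) φ.target

/-- `c : [0, T] → M` is a geodesic of the Levi-Civita connection of `g`: near each parameter it
satisfies, in some chart of the smooth structure, the geodesic equation. -/
def IsLorentzGeodesic (g : LorentzMetric M) (T : ℝ) (c : ℝ → M) : Prop :=
  ContinuousOn c (Icc 0 T) ∧
    ∀ t₀ ∈ Icc 0 T, ∃ φ ∈ IsManifold.maximalAtlas (𝓡 4) ∞ M, c t₀ ∈ φ.source ∧
      ∃ v : ℝ → E4, ∀ᶠ t in 𝓝[Icc 0 T] t₀,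
        SolvesGeodesicEq (christoffel (formInChart g.form φ)) (Icc 0 T) (fun s => φ (c s)) v t

/-- The velocity `c'(t) ∈ T_{c(t)} M` of a curve `c : [0, T] → M`. -/
def velocity (T : ℝ) (c : ℝ → M) (t : ℝ) : TangentSpace (𝓡 4) (c t) :=
  mfderivWithin 𝓘(ℝ, ℝ) (𝓡 4) c (Icc 0 T) t (1 : ℝ)

/-- The curve `c : [0, T] → M` is time-like. -/
def IsTimelike (g : LorentzMetric M) (T : ℝ) (c : ℝ → M) : Prop :=
  ∀ t ∈ Icc 0 T, g.form (c t) (velocity T c t) (velocity T c t) < 0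

/-- `q = exp_m X` for the Levi-Civita connection of `g`: some geodesic `c : [0, 1] → M` starts at
`m` with velocity `X` and ends at `q`. -/
def IsExp (g : LorentzMetric M) (m : M) (X : TangentSpace (𝓡 4) m) (q : M) : Prop :=
  ∃ c : ℝ → M, IsLorentzGeodesic g 1 c ∧
    (⟨c 0, velocity 1 c 0⟩ : TangentBundle (𝓡 4) M) = ⟨m, X⟩ ∧ c 1 = q

/-- The reference frame at an event: a Lorentz-orthonormal basis of `T_m M`, by which `T_m M` is
identified with `ℝ⁴`, and a neighbourhood `O = chart.target` of its origin which `exp_m` identifies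
diffeomorphically with the neighbourhood `chart.source` of `m`. -/
structure ReferenceFrame (g : LorentzMetric M) where
  event : M
  basis : E4 ≃L[ℝ] TangentSpace (𝓡 4) event
  orthonormal : ∀ X Y, g.form event (basis X) (basis Y) = minkowski X Y
  chart : OpenPartialHomeomorph M E4
  chart_mem : chart ∈ IsManifold.maximalAtlas (𝓡 4) ∞ M
  zero_mem : (0 : E4) ∈ chart.target
  exp : ∀ X ∈ chart.target, IsExp g event (basis X) (chart.symm X)

/-- The Lorentz metric on `O ⊆ T_m M ≅ ℝ⁴`. -/
def ReferenceFrame.metric {g : LorentzMetric M} (F : ReferenceFrame g) : FormField :=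
  formInChart g.form F.chart

end Manifold

end

/-! Write `S v` for the development of a control `v` and `P` for the parallel translation of `∇`
along it. The end point `S(u + a)(1)` is a `C¹` function of `(u, a)`, because the equations defining
`(S, P)` form a controlled differential equation with `C¹` right-hand side. Its derivative in `a` at
`u = 0`, `a = T γ'(0)` sends `b` to the end value of the Jacobi field vanishing at `0` with initial
derivative `b`, so it is invertible when the end points are not conjugate, and the implicit
function theorem produces `κ`.

The velocity of `p = S(u + κ(u))` is `P (u + κ(u))`, so `p` is a Levi-Civita geodesic exactly when
`u' = P⁻¹ G_p(P (u + κ(u)), P (u + κ(u)))`. As `P` is an `h`-isometry, the right-hand side has norm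
at most `‖G‖ (ε + C)² ≤ ε` for `u ∈ U_ε`. Hence integrating it from `0` maps `U_ε` into a set of
`ε`-Lipschitz curves in `U_ε`, which is compact, and Schauder's theorem gives a fixed point. The
geodesic so obtained starts with velocity `κ(u)`, so its initial velocity, and hence its velocity
throughout, is time-like. -/

section Brouwer

open Metric MeasureTheory
open scoped NNReal

variable {E F : Type*} [NormedAddCommGroup E] [NormedAddCommGroup F]

theorem lipschitzWith_indicator_of_eqOn_frontier [NormedSpace ℝ E] {f : E → F} {s : Set E} {K : ℝ≥0}
    (hs : IsClosed s) (hf : LipschitzOnWith K f s) (hf₀ : ∀ x ∈ frontier s, f x = 0) :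
    LipschitzWith K (s.indicator f) := by
  have crossing {x y : E} (hx : x ∈ s) (hy : y ∉ s) : ‖f x‖ ≤ K * ‖x - y‖ := by
    obtain ⟨z, hzxy, hz⟩ : ∃ z ∈ segment ℝ x y, z ∈ frontier s := by
      by_contra! hdisj
      have hint {z : E} (hzxy : z ∈ segment ℝ x y) (hz : z ∈ s) : z ∈ interior s := by
        have := hdisj z hzxy
        rw [hs.frontier_eq, Set.mem_sdiff, not_and_not_right] at this
        exact this hz
      refine hy (interior_subset ((convex_segment x y).isPreconnected.subset_left_of_subset_union
        isOpen_interior hs.isOpen_compl (disjoint_compl_right_iff_subset.2 interior_subset)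
        (fun z hz => ?_) ⟨x, left_mem_segment ℝ x y, hint (left_mem_segment ℝ x y) hx⟩
        (right_mem_segment ℝ x y)))
      exact (em (z ∈ s)).imp_left (hint hz)
    have hxz : ‖x - z‖ ≤ ‖x - y‖ := by
      rw [← dist_eq_norm, ← dist_eq_norm, ← dist_add_dist_of_mem_segment hzxy]
      exact le_add_of_nonneg_right dist_nonneg
    calc ‖f x‖ = ‖f x - f z‖ := by rw [hf₀ z hz, sub_zero]
      _ ≤ K * ‖x - z‖ := hf.norm_sub_le hx (hs.frontier_subset hz)
      _ ≤ K * ‖x - y‖ := by gcongr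
  refine LipschitzWith.of_dist_le_mul fun x y => ?_
  rw [dist_eq_norm, dist_eq_norm]
  by_cases hx : x ∈ s <;> by_cases hy : y ∈ s
  · simpa only [indicator_of_mem, hx, hy] using hf.norm_sub_le hx hy
  · simpa only [indicator_of_mem, indicator_of_notMem, hx, hy, not_false_eq_true, sub_zero]
      using crossing hx hy
  · simpa only [indicator_of_mem, indicator_of_notMem, hx, hy, not_false_eq_true, zero_sub,
      norm_neg, norm_sub_rev x y] using crossing hy hx
  · simp only [indicator_of_notMem, hx, hy, not_false_eq_true, sub_zero, norm_zero]
    positivity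

theorem bijective_add_of_lipschitzWith [CompleteSpace E] {k : E → E} {K : ℝ≥0} (hK : K < 1)
    (hk : LipschitzWith K k) : Function.Bijective fun x => x + k x := by
  refine (Function.bijective_iff_existsUnique _).2 fun y => ?_
  have hc : ContractingWith K fun x => y - k x :=
    ⟨hK, LipschitzWith.of_dist_le_mul fun a b => by
      simpa only [dist_sub_left] using hk.dist_le_mul a b⟩
  refine ⟨hc.fixedPoint, ?_, fun x hx => hc.fixedPoint_unique ?_⟩
  · exact (eq_sub_iff_add_eq.1 hc.fixedPoint_isFixedPt.symm)
  · exact (eq_sub_of_add_eq hx).symm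

theorem bijOn_add_of_lipschitzWith [CompleteSpace E] {k : E → E} {s : Set E} {K : ℝ≥0} (hK : K < 1)
    (hk : LipschitzWith K k) (hs : MapsTo (fun x => x + k x) s s) (hk₀ : ∀ x ∉ s, k x = 0) :
    BijOn (fun x => x + k x) s s := by
  have hbij := bijective_add_of_lipschitzWith hK hk
  refine ⟨hs, hbij.injective.injOn, fun y hy => ?_⟩
  obtain ⟨x, rfl⟩ := hbij.surjective y
  refine ⟨x, ?_, rfl⟩
  by_contra hx
  simp only [hk₀ x hx, add_zero] at hy
  exact hx hy

theorem exists_polynomial_eval_eq_det_add_smul {R M : Type*} [CommRing R] [Nontrivial R]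
    [AddCommGroup M] [Module R M] [Module.Free R M] [Module.Finite R M] (f g : M →ₗ[R] M) :
    ∃ p : Polynomial R, p.natDegree ≤ Module.finrank R M ∧
      ∀ s, p.eval s = LinearMap.det (f + s • g) := by
  set b := Module.Free.chooseBasis R M
  refine ⟨_, (Polynomial.natDegree_det_X_add_C_le (LinearMap.toMatrix b b g)
    (LinearMap.toMatrix b b f)).trans_eq (Module.finrank_eq_card_chooseBasisIndex R M).symm,
    fun s => ?_⟩
  rw [← LinearMap.det_toMatrix b, map_add, map_smul, ← Polynomial.coe_evalRingHom, RingHom.map_det]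
  congr 1
  ext i j
  simp [add_comm (LinearMap.toMatrix b b f i j), mul_comm (LinearMap.toMatrix b b g i j)]

theorem integral_eq_of_forall_polynomial {α : Type*} [MeasurableSpace α] {μ : Measure α}
    {f : ℝ → α → ℝ} {n : ℕ} {S : Set ℝ} {c : ℝ}
    (hf : ∀ x, ∃ p : Polynomial ℝ, p.natDegree ≤ n ∧ ∀ s, p.eval s = f s x)
    (hint : ∀ s, Integrable (f s) μ) (hS : S.Infinite) (hc : ∀ s ∈ S, ∫ x, f s x ∂μ = c) (t : ℝ) :
    ∫ x, f t x ∂μ = c := by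
  obtain ⟨v, hvS, hv⟩ := hS.exists_subset_card_eq (n + 1)
  set ℓ : ℝ → ℝ := fun i => (Lagrange.basis v id i).eval t
  have interpolate (p : Polynomial ℝ) (hp : p.natDegree ≤ n) :
      p.eval t = ∑ i ∈ v, p.eval i * ℓ i := by
    have hdeg : p.degree < v.card := by
      rw [hv]
      exact (Polynomial.degree_le_of_natDegree_le hp).trans_lt (mod_cast n.lt_succ_self)
    conv_lhs => rw [Lagrange.eq_interpolate (v := id) (injOn_id _) hdeg]
    simp [Lagrange.interpolate_apply, Polynomial.eval_finsetSum, ℓ]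
  have hsum : ∑ i ∈ v, ℓ i = 1 := by
    simpa using (interpolate (Polynomial.C 1) (by simp)).symm
  calc ∫ x, f t x ∂μ = ∫ x, ∑ i ∈ v, f i x * ℓ i ∂μ := by
        congr 1 with x
        obtain ⟨p, hp, hpf⟩ := hf x
        simpa only [hpf] using interpolate p hp
    _ = ∑ i ∈ v, c * ℓ i := by
        rw [integral_finsetSum _ fun i _ => (hint i).mul_const _]
        exact Finset.sum_congr rfl fun i hi => by rw [integral_mul_const, hc i (hvS hi)]
    _ = c := by rw [← Finset.mul_sum, hsum, mul_one]

theorem det_fderiv_eq_zero_of_eventually_norm_eq [InnerProductSpace ℝ E] [FiniteDimensional ℝ E]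
    {r : E → E} {r' : E →L[ℝ] E} {x : E} (hr : HasFDerivAt r r' x) (hx : r x ≠ 0)
    (hnorm : ∀ᶠ y in 𝓝 x, ‖r y‖ = ‖r x‖) : r'.det = 0 := by
  by_contra hdet
  obtain ⟨w, hw⟩ : ∃ w, r' w = r x := (LinearMap.equivOfDetNeZero _ hdet).surjective (r x)
  have hconst : HasFDerivAt (fun y => ‖r y‖ ^ 2) (0 : E →L[ℝ] ℝ) x :=
    (hasFDerivAt_const (‖r x‖ ^ 2) x).congr_of_eventuallyEq (hnorm.mono fun y hy => by
      simp only [hy])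
  have hzero := congrArg (fun D : E →L[ℝ] ℝ => D w) (hr.norm_sq.unique hconst)
  simp_all

theorem eventually_forall_det_id_add_smul_pos [NormedSpace ℝ E] {𝒟 : Set (E →L[ℝ] E)}
    (h𝒟 : IsCompact 𝒟) :
    ∀ᶠ s in 𝓝 (0 : ℝ), ∀ D ∈ 𝒟, 0 < (ContinuousLinearMap.id ℝ E + s • D).det := by
  refine h𝒟.eventually_forall_of_forall_eventually fun D _ => ?_
  have hcont : Continuous fun q : ℝ × (E →L[ℝ] E) =>
      (ContinuousLinearMap.id ℝ E + q.1 • q.2).det :=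
    ContinuousLinearMap.continuous_det.comp (by fun_prop)
  refine hcont.continuousAt.eventually (lt_mem_nhds ?_)
  simp [ContinuousLinearMap.det]

section Jacobian

variable [NormedSpace ℝ E] [FiniteDimensional ℝ E] [MeasurableSpace E] [BorelSpace E]
  {μ : Measure E} [μ.IsAddHaarMeasure] {f : E → E} {f' : E → E →L[ℝ] E} {s : Set E}

theorem eventually_integral_det_id_add_smul_eq (hs : IsCompact s) (hsc : Convex ℝ s)
    (hf : ∀ x ∈ s, HasFDerivWithinAt f (f' x) s x) (hf' : ContinuousOn f' s)
    (hmaps : MapsTo (fun x => x + f x) s s) (hf₀ : ∀ x ∈ frontier s, f x = 0) :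
    ∀ᶠ t : ℝ in 𝓝[>] 0,
      ∫ x in s, (ContinuousLinearMap.id ℝ E + t • f' x).det ∂μ = μ.real s := by
  obtain ⟨C, hC⟩ := hs.exists_bound_of_continuousOn hf'
  have hlip : LipschitzWith C.toNNReal (s.indicator f) :=
    lipschitzWith_indicator_of_eqOn_frontier hs.isClosed
      (hsc.lipschitzOnWith_of_nnnorm_hasFDerivWithin_le hf fun x hx =>
        NNReal.coe_le_coe.1 ((hC x hx).trans (Real.le_coe_toNNReal C))) hf₀
  have hdet := eventually_forall_det_id_add_smul_pos (hs.image_of_continuousOn hf')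
  have hsmall : ∀ᶠ t : ℝ in 𝓝 0, ‖t‖₊ * C.toNNReal < 1 :=
    Continuous.tendsto' (by fun_prop) 0 0 (by simp) |>.eventually_lt_const one_pos
  filter_upwards [self_mem_nhdsWithin, nhdsWithin_le_nhds (hdet.and hsmall),
    nhdsWithin_le_nhds (Iio_mem_nhds one_pos)] with t ht₀ ⟨htdet, htC⟩ ht₁
  have hbij : BijOn (fun x => x + t • s.indicator f x) s s := by
    refine bijOn_add_of_lipschitzWith htC ((lipschitzWith_smul t).comp hlip) (fun x hx => ?_)
      fun x hx => by simp [hx]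
    simpa [hx] using hsc.add_smul_sub_mem hx (hmaps hx) ⟨(mem_Ioi.1 ht₀).le, (mem_Iio.1 ht₁).le⟩
  have hbij' : BijOn (fun x => x + t • f x) s s := hbij.congr fun x hx => by simp [hx]
  calc ∫ x in s, (ContinuousLinearMap.id ℝ E + t • f' x).det ∂μ
      = ∫ x in s, |(ContinuousLinearMap.id ℝ E + t • f' x).det| • (1 : ℝ) ∂μ :=
        setIntegral_congr_fun hs.measurableSet fun x hx => by
          simp [abs_of_pos (htdet _ (mem_image_of_mem f' hx))]
    _ = ∫ x in (fun x => x + t • f x) '' s, 1 ∂μ :=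
        (integral_image_eq_integral_abs_det_fderiv_smul μ hs.measurableSet
          (fun x hx => (hasFDerivWithinAt_id x s).add ((hf x hx).const_smul t)) hbij'.injOn
          fun _ => 1).symm
    _ = μ.real s := by simp [hbij'.image_eq]

theorem integral_det_eq_of_eqOn_frontier {r : E → E} {r' : E → E →L[ℝ] E} (hs : IsCompact s)
    (hsc : Convex ℝ s) (hr : ∀ x ∈ s, HasFDerivWithinAt r (r' x) s x) (hr' : ContinuousOn r' s)
    (hmaps : MapsTo r s s) (hid : EqOn r id (frontier s)) :
    ∫ x in s, (r' x).det ∂μ = μ.real s := by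
  have hsmall := eventually_integral_det_id_add_smul_eq (μ := μ) hs hsc
    (fun x hx => (hr x hx).sub (hasFDerivWithinAt_id x s)) (hr'.sub continuousOn_const)
    (by simpa using hmaps) fun x hx => sub_eq_zero.2 (hid hx)
  obtain ⟨t₀, ht₀, hsub⟩ := mem_nhdsGT_iff_exists_Ioo_subset.1 hsmall
  have hint (t : ℝ) : IntegrableOn
      (fun x => (ContinuousLinearMap.id ℝ E + t • (r' x - ContinuousLinearMap.id ℝ E)).det) s μ :=
    (ContinuousLinearMap.continuous_det.comp_continuousOn (by fun_prop)).integrableOn_compact hs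
  simpa using integral_eq_of_forall_polynomial
    (fun x => exists_polynomial_eval_eq_det_add_smul _ _) hint
    ((Ioo_infinite ht₀).mono hsub) (fun _ => id) 1

end Jacobian

theorem not_exists_contDiffOn_retraction [InnerProductSpace ℝ E] [FiniteDimensional ℝ E]
    {r : E → E} (hr : ContDiffOn ℝ 1 r (closedBall 0 1))
    (hnorm : ∀ x ∈ closedBall 0 1, ‖r x‖ = 1) (hid : EqOn r id (sphere 0 1)) : False := by
  borelize E
  set B := closedBall (0 : E) 1
  have hB : IsCompact B := isCompact_closedBall 0 1
  have hconv : Convex ℝ B := convex_closedBall 0 1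
  have huniq : UniqueDiffOn ℝ B :=
    uniqueDiffOn_convex hconv (by simp [B, interior_closedBall])
  have hvol : ∫ x in B, (fderivWithin ℝ r B x).det = volume.real B :=
    integral_det_eq_of_eqOn_frontier hB hconv
      (fun x hx => (hr.differentiableOn one_ne_zero x hx).hasFDerivWithinAt)
      (hr.continuousOn_fderivWithin huniq le_rfl)
      (fun x hx => mem_closedBall_zero_iff.2 (hnorm x hx).le)
      (by rwa [frontier_closedBall _ one_ne_zero])
  have hzero : ∫ x in B, (fderivWithin ℝ r B x).det = 0 := by
    refine integral_eq_zero_of_ae ?_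
    filter_upwards [ae_restrict_mem hB.measurableSet, ae_restrict_of_ae
      (measure_eq_zero_iff_ae_notMem.1 (Measure.addHaar_sphere_of_ne_zero volume (0 : E)
        (one_ne_zero (α := ℝ))))] with x hx hxs
    have hxB : B ∈ 𝓝 x := closedBall_mem_nhds_of_mem (mem_ball.2 (lt_of_le_of_ne hx hxs))
    refine det_fderiv_eq_zero_of_eventually_norm_eq
      ((hr.differentiableOn one_ne_zero x hx).hasFDerivWithinAt.hasFDerivAt hxB)
      (norm_ne_zero_iff.1 (by rw [hnorm x hx]; exact one_ne_zero)) ?_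
    filter_upwards [hxB] with y hy
    rw [hnorm x hx, hnorm y hy]
  have hpos : 0 < volume.real B :=
    ENNReal.toReal_pos (measure_closedBall_pos volume 0 one_pos).ne' hB.measure_lt_top.ne
  exact hpos.ne (hzero.symm.trans hvol)

end Brouwer

section Schauder

open Metric

section InnerProductSpace

variable {E : Type*} [NormedAddCommGroup E] [InnerProductSpace ℝ E]

theorem exists_lipschitzWith_one_retraction {K : Set E} (hK : IsComplete K) (hKc : Convex ℝ K)
    (hK₀ : K.Nonempty) :
    ∃ p : E → E, LipschitzWith 1 p ∧ (∀ x, p x ∈ K) ∧ EqOn p id K := by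
  choose p hpK hp using exists_norm_eq_iInf_of_complete_convex hK₀ hK hKc
  have hobtuse (x : E) : ∀ y ∈ K, inner ℝ (x - p x) (y - p x) ≤ 0 :=
    (norm_eq_iInf_iff_real_inner_le_zero hKc (hpK x)).1 (hp x)
  refine ⟨p, LipschitzWith.of_dist_le_mul fun x y => ?_, hpK, fun x hx => ?_⟩
  · have hsq : ‖p x - p y‖ * ‖p x - p y‖ ≤ ‖p x - p y‖ * ‖x - y‖ := by
      calc ‖p x - p y‖ * ‖p x - p y‖ = inner ℝ (p x - p y) (x - y)
            + inner ℝ (x - p x) (p y - p x) + inner ℝ (y - p y) (p x - p y) := by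
            rw [← real_inner_self_eq_norm_mul_norm]
            simp only [inner_sub_left, inner_sub_right, real_inner_comm]
            ring
        _ ≤ ‖p x - p y‖ * ‖x - y‖ := by
            linarith [real_inner_le_norm (p x - p y) (x - y), hobtuse x _ (hpK y),
              hobtuse y _ (hpK x)]
    rw [NNReal.coe_one, one_mul, dist_eq_norm, dist_eq_norm]
    rcases (norm_nonneg (p x - p y)).eq_or_lt with h | h
    · rw [← h]
      exact norm_nonneg _
    · exact le_of_mul_le_mul_left hsq h
  · have := hobtuse x x hx
    rw [real_inner_self_nonpos, sub_eq_zero] at this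
    exact this.symm

theorem norm_add_smul_eq_one {x w : E} (hw : w ≠ 0)
    (h : 0 ≤ inner ℝ x w ^ 2 + ‖w‖ ^ 2 * (1 - ‖x‖ ^ 2)) :
    ‖x + ((-inner ℝ x w + √(inner ℝ x w ^ 2 + ‖w‖ ^ 2 * (1 - ‖x‖ ^ 2))) / ‖w‖ ^ 2) • w‖ = 1 := by
  have hw' := norm_ne_zero_iff.2 hw
  rw [← pow_eq_one_iff_of_nonneg (norm_nonneg _) two_ne_zero, norm_add_sq_real, inner_smul_right,
    norm_smul, mul_pow, Real.norm_eq_abs, sq_abs]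
  field_simp
  linear_combination Real.sq_sqrt h

variable [FiniteDimensional ℝ E]

theorem exists_eq_zero_of_inner_pos {w : E → E} (hw : ContDiffOn ℝ 1 w (closedBall 0 1))
    (hout : ∀ x ∈ sphere (0 : E) 1, 0 < inner ℝ x (w x)) : ∃ x ∈ closedBall (0 : E) 1, w x = 0 := by
  by_contra! hne
  set D : E → ℝ := fun x => inner ℝ x (w x) ^ 2 + ‖w x‖ ^ 2 * (1 - ‖x‖ ^ 2)
  have hD_pos : ∀ x ∈ closedBall (0 : E) 1, 0 < D x := by
    intro x hx
    rcases (mem_closedBall_zero_iff.1 hx).lt_or_eq with hlt | heq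
    · have := norm_pos_iff.2 (hne x hx)
      have : 0 < 1 - ‖x‖ ^ 2 := by nlinarith [norm_nonneg x]
      positivity
    · have := hout x (mem_sphere_zero_iff_norm.2 heq)
      simp only [D, heq]
      simpa using by positivity
  have hinner : ContDiffOn ℝ 1 (fun x => inner ℝ x (w x)) (closedBall 0 1) :=
    contDiffOn_id.inner ℝ hw
  have hD : ContDiffOn ℝ 1 D (closedBall 0 1) :=
    (hinner.pow 2).add ((hw.norm_sq ℝ).mul (contDiffOn_const.sub (contDiffOn_id.norm_sq ℝ)))
  -- follow the line through `x` in the direction `w x` up to the unit sphere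
  refine not_exists_contDiffOn_retraction
    (r := fun x => x + ((-inner ℝ x (w x) + √(D x)) / ‖w x‖ ^ 2) • w x)
    (contDiffOn_id.add (((hinner.neg.add (hD.sqrt fun x hx => (hD_pos x hx).ne')).div
      (hw.norm_sq ℝ) fun x hx => pow_ne_zero 2 (norm_ne_zero_iff.2 (hne x hx))).smul hw))
    (fun x hx => norm_add_smul_eq_one (hne x hx) (hD_pos x hx).le) fun x hx => ?_
  have hDx : D x = inner ℝ x (w x) ^ 2 := by simp [D, mem_sphere_zero_iff_norm.1 hx]
  simp [hDx, Real.sqrt_sq (hout x hx).le]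

theorem exists_fixedPoint_of_continuous_of_norm_le_one {f : E → E} (hf : Continuous f)
    (hf₁ : ∀ x, ‖f x‖ ≤ 1) : ∃ x, f x = x := by
  by_contra! hne
  obtain ⟨x₀, -, hx₀⟩ := (isCompact_closedBall (0 : E) 1).exists_isMinOn ⟨0, by simp⟩
    (hf.sub continuous_id).norm.continuousOn
  set δ := ‖f x₀ - x₀‖
  have hδ : 0 < δ := norm_pos_iff.2 (sub_ne_zero.2 (hne x₀))
  obtain ⟨g, hg⟩ := exists_contMDiffMap_forall_mem_convex_of_local_const (n := ⊤)
    (modelWithCornersSelf ℝ E) (t := fun x => ball (f x) δ ∩ closedBall 0 1)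
    (fun x => (convex_ball _ _).inter (convex_closedBall _ _)) (fun x => ⟨f x, by
      filter_upwards [hf.continuousAt.eventually (ball_mem_nhds (f x) hδ)] with y hy
      exact ⟨mem_ball_comm.1 hy, by simpa using hf₁ x⟩⟩)
  have hg_smooth : ContDiff ℝ 1 g := g.contMDiff.contDiff.of_le (mod_cast le_top)
  have hg_ne : ∀ x ∈ closedBall (0 : E) 1, x - g x ≠ 0 := by
    intro x hx hzero
    have hclose : dist (g x) (f x) < δ := (hg x).1
    rw [← sub_eq_zero.1 hzero, dist_comm, dist_eq_norm] at hclose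
    exact (hx₀ hx).not_gt hclose
  obtain ⟨x, hx, hzero⟩ := exists_eq_zero_of_inner_pos (contDiff_id.sub hg_smooth).contDiffOn
    fun x hx => by
      have hx₁ := mem_sphere_zero_iff_norm.1 hx
      have hgx : ‖g x‖ ≤ 1 := mem_closedBall_zero_iff.1 (hg x).2
      have hsq := norm_sub_sq_real x (g x)
      have hpos : 0 < ‖x - g x‖ := norm_pos_iff.2 (hg_ne x (sphere_subset_closedBall hx))
      simp only [id, inner_sub_right, real_inner_self_eq_norm_sq, hx₁] at hsq ⊢
      nlinarith [norm_nonneg (g x)]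
  exact hg_ne x hx hzero

end InnerProductSpace

section NormedSpace

variable {E : Type*} [NormedAddCommGroup E] [NormedSpace ℝ E] {K : Set E} {f : E → E}

theorem brouwer_fixedPoint [FiniteDimensional ℝ E] (hK : IsCompact K)
    (hKc : Convex ℝ K) (hK₀ : K.Nonempty) (hf : ContinuousOn f K) (hfK : MapsTo f K K) :
    ∃ x ∈ K, f x = x := by
  set e : E ≃L[ℝ] EuclideanSpace ℝ (Fin (Module.finrank ℝ E)) := toEuclidean
  have heK : IsCompact (e '' K) := hK.image e.continuous
  obtain ⟨p, hp, hpK, hp_id⟩ := exists_lipschitzWith_one_retraction heK.isComplete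
    (hKc.is_linear_image e.toLinearMap.isLinear) (hK₀.image e)
  have hsymm (x) : e.symm (p x) ∈ K := by
    obtain ⟨y, hy, hyx⟩ := hpK x
    rwa [← hyx, e.symm_apply_apply]
  obtain ⟨R, hR, hRK⟩ := heK.isBounded.exists_pos_norm_le
  obtain ⟨x, hx⟩ := exists_fixedPoint_of_continuous_of_norm_le_one
    (f := fun x => R⁻¹ • e (f (e.symm (p (R • x)))))
    ((e.continuous.comp (hf.comp_continuous (e.symm.continuous.comp
      (hp.continuous.comp (continuous_const_smul R))) fun x => hsymm _)).const_smul R⁻¹)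
    fun x => by
      rw [norm_smul, norm_inv, Real.norm_of_nonneg hR.le, inv_mul_le_one₀ hR]
      exact hRK _ (mem_image_of_mem e (hfK (hsymm _)))
  have hfx : e (f (e.symm (p (R • x)))) = R • x :=
    (inv_smul_eq_iff₀ hR.ne').1 hx
  have hRx : p (R • x) = R • x := hp_id (hfx ▸ mem_image_of_mem e (hfK (hsymm _)))
  refine ⟨e.symm (R • x), hRx ▸ hsymm _, e.injective ?_⟩
  rwa [e.apply_symm_apply, ← congrArg (fun y => e (f (e.symm y))) hRx]

theorem exists_continuousOn_stdSimplex_of_isCompact {X : Type*} [PseudoMetricSpace X] {K : Set X}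
    (hK : IsCompact K) {ε : ℝ} (hε : 0 < ε) :
    ∃ (t : Finset X) (ψ : X → t → ℝ), ↑t ⊆ K ∧ ContinuousOn ψ K ∧ MapsTo ψ K (stdSimplex ℝ t) ∧
      ∀ x i, ψ x i ≠ 0 → dist x i < ε := by
  obtain ⟨t, htK, htf, hcov⟩ := hK.finite_cover_balls hε
  lift t to Finset X using htf
  set φ : X → t → ℝ := fun x i => max (ε - dist x i) 0
  have hφ (x) (i) : 0 ≤ φ x i := le_max_right _ _
  have hφ_pos : ∀ x ∈ K, 0 < ∑ i, φ x i := by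
    intro x hx
    obtain ⟨y, hy, hxy⟩ := mem_iUnion₂.1 (hcov hx)
    exact Finset.sum_pos' (fun i _ => hφ x i)
      ⟨⟨y, hy⟩, Finset.mem_univ _, lt_max_of_lt_left (sub_pos.2 hxy)⟩
  refine ⟨t, fun x i => φ x i / ∑ j, φ x j, htK, continuousOn_pi.2 fun i =>
    ContinuousOn.div (by fun_prop) (by fun_prop) fun x hx => (hφ_pos x hx).ne', fun x hx =>
      ⟨fun i => div_nonneg (hφ x i) (hφ_pos x hx).le, ?_⟩, fun x i hi => ?_⟩
  · rw [← Finset.sum_div, div_self (hφ_pos x hx).ne']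
  · contrapose! hi
    simp [φ, max_eq_right (sub_nonpos.2 hi)]

theorem exists_norm_sub_le_of_mapsTo (hK : IsCompact K) (hKc : Convex ℝ K) (hK₀ : K.Nonempty)
    (hf : ContinuousOn f K) (hfK : MapsTo f K K) {ε : ℝ} (hε : 0 < ε) :
    ∃ x ∈ K, ‖f x - x‖ ≤ ε := by
  obtain ⟨t, ψ, htK, hψ, hψK, hψε⟩ := exists_continuousOn_stdSimplex_of_isCompact hK hε
  obtain ⟨x₀, hx₀⟩ := hK₀
  set σ : (t → ℝ) → E := fun l => ∑ i, l i • (i : E)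
  have hσ : MapsTo σ (stdSimplex ℝ t) K := fun l hl =>
    hKc.sum_mem (fun i _ => hl.1 i) hl.2 fun i _ => htK i.2
  obtain ⟨l, hl, hfix⟩ := brouwer_fixedPoint (isCompact_stdSimplex ℝ t)
    (convex_stdSimplex ℝ t) ⟨_, hψK hx₀⟩
    (hψ.comp (hf.comp (by fun_prop) hσ) (hfK.comp hσ)) (hψK.comp (hfK.comp hσ))
  refine ⟨σ l, hσ hl, ?_⟩
  calc ‖f (σ l) - σ l‖ = ‖∑ i, l i • (f (σ l) - i)‖ := by
        simp_rw [smul_sub, Finset.sum_sub_distrib, ← Finset.sum_smul, hl.2, one_smul, σ]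
    _ ≤ ∑ i, l i * ε := by
        refine norm_sum_le_of_le _ fun i _ => ?_
        rw [norm_smul, Real.norm_of_nonneg (hl.1 i)]
        rcases eq_or_ne (l i) 0 with hi | hi
        · simp [hi]
        · rw [← dist_eq_norm]
          exact mul_le_mul_of_nonneg_left (hψε _ i (by rwa [← hfix] at hi)).le (hl.1 i)
    _ = ε := by rw [← Finset.sum_mul, hl.2, one_mul]

theorem schauder_fixedPoint (hK : IsCompact K) (hKc : Convex ℝ K) (hK₀ : K.Nonempty)
    (hf : ContinuousOn f K) (hfK : MapsTo f K K) : ∃ x ∈ K, f x = x := by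
  obtain ⟨x, hx, hmin⟩ := hK.exists_isMinOn hK₀ (hf.sub continuousOn_id).norm
  refine ⟨x, hx, sub_eq_zero.1 (norm_le_zero_iff.1 (le_of_forall_pos_le_add fun ε hε => ?_))⟩
  obtain ⟨y, hy, hye⟩ := exists_norm_sub_le_of_mapsTo hK hKc hK₀ hf hfK hε
  rw [zero_add]
  exact (hmin hy).trans hye

end NormedSpace

end Schauder

section ControlledEquation

open unitInterval

variable {K X V Z : Type*} [TopologicalSpace K] [CompactSpace K]
  [NormedAddCommGroup X] [NormedSpace ℝ X]
  [NormedAddCommGroup V] [NormedSpace ℝ V] [NormedAddCommGroup Z] [NormedSpace ℝ Z]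

/-- Pointwise application of a continuous family of operators, as a bounded operator between spaces
of continuous maps. -/
noncomputable def pointwiseApply (A : C(K, Z →L[ℝ] X)) : C(K, Z) →L[ℝ] C(K, X) :=
  LinearMap.mkContinuous
    { toFun := fun z => ⟨fun k => A k (z k), by fun_prop⟩
      map_add' := fun _ _ => by ext; simp
      map_smul' := fun _ _ => by ext; simp } ‖A‖ fun z =>
    (ContinuousMap.norm_le _ (by positivity)).2 fun k =>
      (A k).le_of_opNorm_le_of_le (A.norm_coe_le_norm k) (z.norm_coe_le_norm k)

@[simp]
theorem pointwiseApply_apply (A : C(K, Z →L[ℝ] X)) (z : C(K, Z)) (k : K) :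
    pointwiseApply A z k = A k (z k) := rfl

theorem hasStrictFDerivAt_continuousMap_comp {G : C(Z, X)} {G' : C(Z, Z →L[ℝ] X)}
    (hG : ∀ z, HasStrictFDerivAt G (G' z) z) (z₀ : C(K, Z)) :
    HasStrictFDerivAt (fun z : C(K, Z) => G.comp z) (pointwiseApply (G'.comp z₀)) z₀ := by
  refine .of_isLittleO (Asymptotics.isLittleO_iff.2 fun c hc => ?_)
  have huniform : ∀ᶠ p : C(K, Z) × C(K, Z) in 𝓝 (z₀, z₀), ∀ k ∈ (univ : Set K),
      ‖G (p.1 k) - G (p.2 k) - G' (z₀ k) (p.1 k - p.2 k)‖ ≤ c * ‖p.1 k - p.2 k‖ := by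
    refine isCompact_univ.eventually_forall_of_forall_eventually fun k _ => ?_
    have heval : Tendsto (fun q : (C(K, Z) × C(K, Z)) × K => (q.1.1 q.2, q.1.2 q.2))
        (𝓝 ((z₀, z₀), k)) (𝓝 (z₀ k, z₀ k)) := by
      refine Continuous.tendsto' (by fun_prop) _ _ rfl
    have hderiv : ∀ᶠ q : (C(K, Z) × C(K, Z)) × K in 𝓝 ((z₀, z₀), k),
        ‖G' (z₀ q.2) - G' (z₀ k)‖ < c / 2 := by
      refine Tendsto.eventually_lt_const (half_pos hc) (Continuous.tendsto' (by fun_prop) _ _ ?_)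
      simp
    filter_upwards [heval.eventually ((hG (z₀ k)).isLittleO.bound (half_pos hc)), hderiv]
      with q hstrict hq
    calc _ = ‖(G (q.1.1 q.2) - G (q.1.2 q.2) - G' (z₀ k) (q.1.1 q.2 - q.1.2 q.2)) -
          (G' (z₀ q.2) - G' (z₀ k)) (q.1.1 q.2 - q.1.2 q.2)‖ := by
          rw [sub_apply]; abel_nf
      _ ≤ c / 2 * ‖q.1.1 q.2 - q.1.2 q.2‖ + c / 2 * ‖q.1.1 q.2 - q.1.2 q.2‖ :=
          norm_sub_le_of_le hstrict (ContinuousLinearMap.le_of_opNorm_le _ hq.le _)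
      _ = c * ‖q.1.1 q.2 - q.1.2 q.2‖ := by ring
  filter_upwards [huniform] with p hp
  exact (ContinuousMap.norm_le _ (by positivity)).2 fun k => (hp k (mem_univ k)).trans <|
    mul_le_mul_of_nonneg_left ((p.1 - p.2).norm_coe_le_norm k) hc.le

/-- The primitive vanishing at `0`, as a bounded operator on `C([0, 1], X)`. -/
noncomputable def primitive : C(I, X) →L[ℝ] C(I, X) :=
  LinearMap.mkContinuous
    { toFun := fun y => ⟨fun t => ∫ s in (0 : ℝ)..t, IccExtend zero_le_one y s,
        (intervalIntegral.continuous_primitive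
          (fun _ _ => (y.continuous.Icc_extend' (h := zero_le_one)).intervalIntegrable _ _) 0).comp
          continuous_subtype_val⟩
      map_add' := fun y z => by
        ext t
        exact intervalIntegral.integral_add
          ((y.continuous.Icc_extend' (h := zero_le_one)).intervalIntegrable _ _)
          ((z.continuous.Icc_extend' (h := zero_le_one)).intervalIntegrable _ _)
      map_smul' := fun c y => by
        ext t
        exact intervalIntegral.integral_smul c (IccExtend zero_le_one y) } 1 fun y =>
    (ContinuousMap.norm_le _ (by positivity)).2 fun t =>
      (intervalIntegral.norm_integral_le_of_norm_le_const (C := ‖y‖)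
        fun _ _ => y.norm_coe_le_norm _).trans <| by
        rw [sub_zero, abs_of_nonneg t.2.1, one_mul]
        exact mul_le_of_le_one_right (norm_nonneg y) t.2.2

theorem primitive_apply (y : C(I, X)) (t : I) :
    primitive y t = ∫ s in (0 : ℝ)..t, IccExtend zero_le_one y s := rfl

@[simp]
theorem primitive_apply_zero (y : C(I, X)) : primitive y 0 = 0 := by
  simp [primitive_apply]

/-- The Volterra operator `y ↦ ∫₀ᵗ A(s) y(s) ds`. -/
noncomputable def volterra (A : C(I, X →L[ℝ] X)) : C(I, X) →L[ℝ] C(I, X) :=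
  primitive ∘L pointwiseApply A

theorem norm_volterra_pow_apply_le (A : C(I, X →L[ℝ] X)) (y : C(I, X)) (n : ℕ) (t : I) :
    ‖(volterra A ^ n) y t‖ ≤ (‖A‖ * t) ^ n / n.factorial * ‖y‖ := by
  induction n generalizing t with
  | zero => simpa using y.norm_coe_le_norm t
  | succ n ih =>
    have hbound : ∀ s ∈ Ioc (0 : ℝ) t,
        ‖IccExtend zero_le_one (pointwiseApply A ((volterra A ^ n) y)) s‖ ≤
          ‖A‖ ^ (n + 1) / n.factorial * ‖y‖ * s ^ n := fun s hs => by
      have hs' : s ∈ I := ⟨hs.1.le, hs.2.trans t.2.2⟩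
      rw [IccExtend_of_mem _ _ hs', pointwiseApply_apply]
      refine (ContinuousLinearMap.le_of_opNorm_le_of_le _ (A.norm_coe_le_norm _)
        (ih ⟨s, hs'⟩)).trans_eq ?_
      rw [mul_pow]; ring
    rw [pow_succ']
    refine (intervalIntegral.norm_integral_le_of_norm_le t.2.1 (.of_forall hbound)
      (Continuous.intervalIntegrable (by fun_prop) _ _)).trans_eq ?_
    rw [intervalIntegral.integral_const_mul, integral_pow, Nat.factorial_succ, mul_pow]
    push_cast
    field_simp
    simp

theorem isInvertible_one_sub_volterra [CompleteSpace X] (A : C(I, X →L[ℝ] X)) :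
    (1 - volterra A).IsInvertible := by
  obtain ⟨n, hn⟩ := ((FloorSemiring.tendsto_pow_div_factorial_atTop ‖A‖).eventually_lt_const
    one_pos).exists
  have hpow : ‖volterra A ^ n‖ < 1 := by
    refine (ContinuousLinearMap.opNorm_le_bound _ (by positivity) fun y =>
      (ContinuousMap.norm_le _ (by positivity)).2 fun t =>
        (norm_volterra_pow_apply_le A y n t).trans ?_).trans_lt hn
    gcongr
    · exact mul_nonneg (norm_nonneg A) t.2.1
    · exact mul_le_of_le_one_right (norm_nonneg A) t.2.2
  have hunit := isUnit_one_sub_of_norm_lt_one (x := volterra A ^ n) hpow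
  rw [← mul_neg_geom_sum] at hunit
  have hcomm : Commute (1 - volterra A) (∑ i ∈ Finset.range n, volterra A ^ i) :=
    (mul_neg_geom_sum _ _).trans (geom_sum_mul_neg _ _).symm
  obtain ⟨u, hu⟩ := (hcomm.isUnit_mul_iff.1 hunit).1
  exact ⟨ContinuousLinearEquiv.ofUnit u, hu⟩

theorem eq_const_add_primitive_iff [CompleteSpace X] {y f : C(I, X)} :
    y = ContinuousMap.const I (y 0) + primitive f ↔ ∀ t ∈ Icc (0 : ℝ) 1,
      HasDerivWithinAt (IccExtend zero_le_one y) (IccExtend zero_le_one f t) (Icc 0 1) t := by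
  have hf : Continuous (IccExtend zero_le_one f) := f.continuous.Icc_extend'
  refine ⟨fun h t ht => ?_, fun h => ContinuousMap.ext fun t => ?_⟩
  · have : Fact (t ∈ Icc (0 : ℝ) 1) := ⟨ht⟩
    refine ((intervalIntegral.integral_hasDerivWithinAt_right (hf.intervalIntegrable 0 t)
      (hf.stronglyMeasurableAtFilter _ _) hf.continuousWithinAt).const_add (y 0)).congr_of_mem
      (fun s hs => ?_) ht
    rw [IccExtend_of_mem _ _ hs, h]
    simp [primitive_apply]
  · have hint := intervalIntegral.integral_eq_sub_of_hasDeriv_right_of_le t.2.1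
      (fun s hs => ((h s ⟨hs.1, hs.2.trans t.2.2⟩).continuousWithinAt.mono
        (Icc_subset_Icc_right t.2.2)))
      (fun s hs => (h s ⟨hs.1.le, hs.2.le.trans t.2.2⟩).mono_of_mem_nhdsWithin
        (Icc_mem_nhdsGT_of_mem ⟨hs.1.le, hs.2.trans_le t.2.2⟩)) (hf.intervalIntegrable 0 t)
    simp [primitive_apply, hint]

theorem exists_hasDerivWithinAt_linear [CompleteSpace X] (A : C(I, X →L[ℝ] X)) (x₀ : X) :
    ∃ z : ℝ → X, z 0 = x₀ ∧
      ∀ t ∈ Icc (0 : ℝ) 1, HasDerivWithinAt z (IccExtend zero_le_one A t (z t)) (Icc 0 1) t := by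
  obtain ⟨z, hz⟩ := (isInvertible_one_sub_volterra A).surjective (.const I x₀)
  have hz' : z = .const I x₀ + primitive (pointwiseApply A z) := sub_eq_iff_eq_add.1 hz
  have h₀ : z 0 = x₀ := by rw [hz']; simp
  refine ⟨IccExtend zero_le_one z, by rwa [IccExtend_left], ?_⟩
  exact eq_const_add_primitive_iff.1 (by rwa [h₀])

/-- The curve `y` solves, on `[0, 1]`, the autonomous equation `y' = F(y, w)` with control `w`. -/
def IsControlledCurve (F : X × V → X) (w : ℝ → V) (y : ℝ → X) : Prop :=
  IsIntegralCurveOn y (fun t x => F (x, w t)) (Icc 0 1)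

theorem IsControlledCurve.eqOn {F : X × V → X} (hF : ContDiff ℝ 1 F) {w : ℝ → V} {y₁ y₂ : ℝ → X}
    (hw : ContinuousOn w (Icc 0 1)) (h₁ : IsControlledCurve F w y₁)
    (h₂ : IsControlledCurve F w y₂) (h₀ : y₁ 0 = y₂ 0) : EqOn y₁ y₂ (Icc 0 1) := by
  set S : Set (X × V) :=
    (fun t => (y₁ t, w t)) '' Icc (0 : ℝ) 1 ∪ (fun t => (y₂ t, w t)) '' Icc (0 : ℝ) 1
  have hS : IsCompact S := (isCompact_Icc.image_of_continuousOn (h₁.continuousOn.prodMk hw)).union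
    (isCompact_Icc.image_of_continuousOn (h₂.continuousOn.prodMk hw))
  obtain ⟨K, hK⟩ := hF.locallyLipschitz.locallyLipschitzOn.exists_lipschitzOnWith_of_compact hS
  have hderiv : ∀ y : ℝ → X, IsControlledCurve F w y →
      ∀ t ∈ Ico (0 : ℝ) 1, HasDerivWithinAt y (F (y t, w t)) (Ici t) t := fun y hy t ht =>
    (hy t (Ico_subset_Icc_self ht)).mono_of_mem_nhdsWithin (Icc_mem_nhdsGE_of_mem ht)
  exact ODE_solution_unique_of_mem_Icc_right (s := fun t => {x | (x, w t) ∈ S})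
    (fun t _ x hx y hy => by simpa [Prod.edist_eq] using hK hx hy)
    h₁.continuousOn (hderiv y₁ h₁) (fun t ht => .inl ⟨t, Ico_subset_Icc_self ht, rfl⟩)
    h₂.continuousOn (hderiv y₂ h₂) (fun t ht => .inr ⟨t, Ico_subset_Icc_self ht, rfl⟩) h₀

/-- The pairing `(w, y) ↦ (t ↦ (y t, w t))` as a bounded operator. -/
noncomputable def pairing : C(I, V) × C(I, X) →L[ℝ] C(I, X × V) :=
  ((ContinuousLinearMap.inr ℝ X V).compLeftContinuous ℝ I).coprod
    ((ContinuousLinearMap.inl ℝ X V).compLeftContinuous ℝ I)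

@[simp]
theorem pairing_apply (p : C(I, V) × C(I, X)) (t : I) : pairing p t = (p.2 t, p.1 t) := by
  simp [pairing]

/-- The map whose value at `(w, y)` is constant in `t` exactly when `y' = F(y, w)`. -/
noncomputable def integralResidual (F : C(X × V, X)) (p : C(I, V) × C(I, X)) : C(I, X) :=
  p.2 - primitive (F.comp (pairing p))

theorem isControlledCurve_iff_integralResidual_eq [CompleteSpace X] {F : C(X × V, X)}
    {w : C(I, V)} {y : C(I, X)} :
    IsControlledCurve F (IccExtend zero_le_one w) (IccExtend zero_le_one y) ↔
      integralResidual F (w, y) = .const I (y 0) := by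
  rw [integralResidual, sub_eq_iff_eq_add, eq_const_add_primitive_iff]
  simp [IsControlledCurve, IsIntegralCurveOn, IccExtend]

theorem isInvertible_linearizedResidual_comp_inr [CompleteSpace X] (A : C(I, X × V →L[ℝ] X)) :
    ((.snd ℝ _ _ - primitive ∘L pointwiseApply A ∘L pairing) ∘L
      .inr ℝ C(I, V) C(I, X)).IsInvertible := by
  set B : C(I, X →L[ℝ] X) := ⟨fun t => A t ∘L .inl ℝ X V, by fun_prop⟩
  have hB : pointwiseApply A ∘L pairing ∘L .inr ℝ C(I, V) C(I, X) = pointwiseApply B := by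
    ext z t
    simp [B]
  rw [ContinuousLinearMap.sub_comp, ContinuousLinearMap.snd_comp_inr]
  simp only [ContinuousLinearMap.comp_assoc, hB]
  exact isInvertible_one_sub_volterra B

theorem hasStrictFDerivAt_integralResidual {F : C(X × V, X)} {F' : C(X × V, X × V →L[ℝ] X)}
    (hF : ∀ z, HasStrictFDerivAt F (F' z) z) (p : C(I, V) × C(I, X)) :
    HasStrictFDerivAt (integralResidual F) (.snd ℝ _ _ -
      primitive ∘L pointwiseApply (F'.comp (pairing p)) ∘L pairing) p :=
  hasStrictFDerivAt_snd.sub (primitive.hasStrictFDerivAt.comp p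
    ((hasStrictFDerivAt_continuousMap_comp hF _).comp p pairing.hasStrictFDerivAt))

theorem exists_hasStrictFDerivAt_controlledCurve [CompleteSpace X] [CompleteSpace V]
    {F : X × V → X} (hF : ContDiff ℝ 1 F) {v : C(I, V)} {y : C(I, X)}
    (hy : IsControlledCurve F (IccExtend zero_le_one v) (IccExtend zero_le_one y)) :
    ∃ (Y : C(I, V) → C(I, X)) (Y' : C(I, V) →L[ℝ] C(I, X)), HasStrictFDerivAt Y Y' v ∧ Y v = y ∧
      (∀ᶠ w in 𝓝 v, Y w 0 = y 0 ∧
        IsControlledCurve F (IccExtend zero_le_one w) (IccExtend zero_le_one (Y w))) ∧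
      ∀ w, Y' w 0 = 0 ∧ ∀ t ∈ Icc (0 : ℝ) 1,
        HasDerivWithinAt (IccExtend zero_le_one (Y' w))
          (fderiv ℝ F (IccExtend zero_le_one y t, IccExtend zero_le_one v t)
            (IccExtend zero_le_one (Y' w) t, IccExtend zero_le_one w t)) (Icc 0 1) t := by
  lift F to C(X × V, X) using hF.continuous
  set F' : C(X × V, X × V →L[ℝ] X) := ⟨fderiv ℝ F, hF.continuous_fderiv one_ne_zero⟩
  have hF' : ∀ z, HasStrictFDerivAt F (F' z) z := fun z =>
    hF.contDiffAt.hasStrictFDerivAt one_ne_zero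
  have hΨ := hasStrictFDerivAt_integralResidual hF' (v, y)
  set Ψ' : C(I, V) × C(I, X) →L[ℝ] C(I, X) := .snd ℝ _ _ -
    primitive ∘L pointwiseApply (F'.comp (pairing (v, y))) ∘L pairing
  have hinv : (Ψ' ∘L .inr ℝ _ _).IsInvertible := isInvertible_linearizedResidual_comp_inr _
  obtain ⟨Y, hY⟩ : ∃ Y, Y = hΨ.implicitFunctionOfProdDomain hinv := ⟨_, rfl⟩
  obtain ⟨Y', hYY'⟩ : ∃ Y' : C(I, V) →L[ℝ] C(I, X), HasStrictFDerivAt Y Y' v :=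
    ⟨_, hY ▸ hΨ.hasStrictFDerivAt_implicitFunctionOfProdDomain hinv⟩
  have hYv : Y v = y :=
    hY ▸ (hΨ.eventually_apply_eq_iff_implicitFunctionOfProdDomain hinv).self_of_nhds.1 rfl
  have hΨY : ∀ᶠ w in 𝓝 v, integralResidual F (w, Y w) = .const I (y 0) := by
    rw [← isControlledCurve_iff_integralResidual_eq.1 hy, hY]
    exact hΨ.eventually_apply_implicitFunctionOfProdDomain hinv
  have hΨY' : Ψ' ∘L (ContinuousLinearMap.id ℝ _).prod Y' = 0 := by
    rw [← hYv] at hΨ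
    have hcomp := hΨ.hasFDerivAt.comp v ((hasFDerivAt_id v).prodMk hYY'.hasFDerivAt)
    exact (hcomp.congr_of_eventuallyEq (hΨY.mono fun _ h => h.symm)).unique (hasFDerivAt_const _ _)
  refine ⟨Y, Y', hYY', hYv, hΨY.mono fun w hw => ?_, fun w => ?_⟩
  · have h₀ : Y w 0 = y 0 := by simpa [integralResidual] using congr($hw 0)
    exact ⟨h₀, isControlledCurve_iff_integralResidual_eq.2 (h₀ ▸ hw)⟩
  · set f : C(I, X) := pointwiseApply (F'.comp (pairing (v, y))) (pairing (w, Y' w))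
    have hw : Y' w = primitive f := sub_eq_zero.1 congr($hΨY' w)
    have h₀ : Y' w 0 = 0 := by rw [hw, primitive_apply_zero]
    refine ⟨h₀, fun t ht => ?_⟩
    have hconst : Y' w = .const I (Y' w 0) + primitive f := by
      rwa [h₀, ContinuousMap.const_zero, zero_add]
    simpa [f, IccExtend, F'] using eq_const_add_primitive_iff.1 hconst t ht

end ControlledEquation

section RiemannianNorm

theorem exists_linearEquiv_inner_eq {V : Type*} [AddCommGroup V] [Module ℝ V]
    [FiniteDimensional ℝ V] {n : ℕ} (hn : Module.finrank ℝ V = n) (B : V →ₗ[ℝ] V →ₗ[ℝ] ℝ)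
    (hsymm : ∀ X Y, B X Y = B Y X) (hpos : ∀ X, X ≠ 0 → 0 < B X X) :
    ∃ L : V ≃ₗ[ℝ] EuclideanSpace ℝ (Fin n), ∀ X Y, inner ℝ (L X) (L Y) = B X Y := by
  have hnonneg (X : V) : 0 ≤ B X X := by
    rcases eq_or_ne X 0 with rfl | hX
    · simp
    · exact (hpos X hX).le
  let core : InnerProductSpace.Core ℝ V :=
    { inner := fun X Y => B X Y
      conj_inner_symm := fun X Y => hsymm Y X
      re_inner_nonneg := hnonneg
      add_left := fun X Y Z => by simp
      smul_left := fun X Y r => by simp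
      definite := fun X hX => by_contra fun h => (hpos X h).ne' hX }
  let : NormedAddCommGroup V := core.toNormedAddCommGroup
  let : InnerProductSpace ℝ V := .ofCore core.toCore
  let L := ((stdOrthonormalBasis ℝ V).reindex (finCongr hn)).repr
  exact ⟨L.toLinearEquiv, fun X Y => L.inner_map_map X Y⟩

variable {h : FormField}

theorem IsRiemannianMetric.exists_equiv_norm_eq_rnorm (hh : IsRiemannianMetric h) (x : E4) :
    ∃ L : E4 ≃L[ℝ] E4, ∀ X, ‖L X‖ = rnorm h x X := by
  obtain ⟨L, hL⟩ := exists_linearEquiv_inner_eq finrank_euclideanSpace_fin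
    (ContinuousLinearMap.coeLM ℝ ∘ₗ (h x).toLinearMap) (hh.symm x) (hh.pos x)
  refine ⟨L.toContinuousLinearEquiv, fun X => ?_⟩
  rw [norm_eq_sqrt_real_inner]
  exact congrArg Real.sqrt (hL X X)

theorem rnorm_smul (x : E4) (c : ℝ) (X : E4) : rnorm h x (c • X) = |c| * rnorm h x X := by
  have : h x (c • X) (c • X) = c ^ 2 * h x X X := by simp; ring
  rw [rnorm, this, Real.sqrt_mul (sq_nonneg c), Real.sqrt_sq_eq_abs, rnorm]

theorem mem_curveBall_iff {L : E4 ≃L[ℝ] E4} {x₀ : E4} (hL : ∀ X, ‖L X‖ = rnorm h x₀ X) {ε : ℝ}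
    (u : C(Icc (0 : ℝ) 1, E4)) :
    u ∈ curveBall h x₀ ε ↔
      L.toContinuousLinearMap.compLeftContinuous ℝ (Icc (0 : ℝ) 1) u ∈ Metric.closedBall 0 ε := by
  have : Nonempty (Icc (0 : ℝ) 1) := ⟨0, by simp⟩
  rw [mem_closedBall_zero_iff, ContinuousMap.norm_le_of_nonempty]
  exact forall_congr' fun t => by rw [← hL]; rfl

theorem IsRiemannianMetric.exists_curveBall_subset (hh : IsRiemannianMetric h) (x₀ : E4)
    {s : Set C(Icc (0 : ℝ) 1, E4)} (hs : s ∈ 𝓝 0) : ∃ ε > 0, curveBall h x₀ ε ⊆ s := by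
  obtain ⟨L, hL⟩ := hh.exists_equiv_norm_eq_rnorm x₀
  let E := L.symm.toContinuousLinearMap.compLeftContinuous ℝ (Icc (0 : ℝ) 1)
  obtain ⟨ε, hε, hsub⟩ := Metric.nhds_basis_closedBall.mem_iff.1
    (E.continuous.continuousAt.preimage_mem_nhds (by rwa [map_zero]) : E ⁻¹' s ∈ 𝓝 0)
  refine ⟨ε, hε, fun u hu => ?_⟩
  have := hsub ((mem_curveBall_iff hL u).1 hu)
  have hu' : E (L.toContinuousLinearMap.compLeftContinuous ℝ (Icc (0 : ℝ) 1) u) = u := by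
    ext1 t; exact L.symm_apply_apply (u t)
  rwa [mem_preimage, hu'] at this

end RiemannianNorm

section Development

open unitInterval

theorem isInvertible_of_injective {V W : Type*} [NormedAddCommGroup V] [NormedSpace ℝ V]
    [FiniteDimensional ℝ V] [NormedAddCommGroup W] [NormedSpace ℝ W] [FiniteDimensional ℝ W]
    (hVW : Module.finrank ℝ V = Module.finrank ℝ W) {A : V →L[ℝ] W} (hA : Function.Injective A) :
    A.IsInvertible :=
  ⟨(LinearEquiv.ofInjectiveOfFinrankEq A.toLinearMap hA hVW).toContinuousLinearEquiv, rfl⟩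

theorem hasDerivWithinAt_fst {X Y : Type*} [NormedAddCommGroup X] [NormedSpace ℝ X]
    [NormedAddCommGroup Y] [NormedSpace ℝ Y] {f : ℝ → X × Y} {f' : X × Y} {s : Set ℝ} {t : ℝ}
    (hf : HasDerivWithinAt f f' s t) : HasDerivWithinAt (fun t => (f t).1) f'.1 s t :=
  (hasFDerivAt_fst.comp_hasDerivWithinAt t hf :)

theorem hasDerivWithinAt_snd {X Y : Type*} [NormedAddCommGroup X] [NormedSpace ℝ X]
    [NormedAddCommGroup Y] [NormedSpace ℝ Y] {f : ℝ → X × Y} {f' : X × Y} {s : Set ℝ} {t : ℝ}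
    (hf : HasDerivWithinAt f f' s t) : HasDerivWithinAt (fun t => (f t).2) f'.2 s t :=
  (hasFDerivAt_snd.comp_hasDerivWithinAt t hf :)

/-- The right-hand side of the equation `p' = P v`, `P' = -Γ_p(P v) P` of the development `p = S v`
and of the parallel translation `P` along it, as a function of `((p, P), v)`. -/
noncomputable def developmentField (Γ : ConnectionField) (q : (E4 × (E4 →L[ℝ] E4)) × E4) :
    E4 × (E4 →L[ℝ] E4) :=
  (q.1.2 q.2, -((Γ q.1.1 (q.1.2 q.2)).comp q.1.2))

variable {Γ : ConnectionField} {p q : ℝ → E4}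

theorem isDevelopment_iff {x₀ : E4} {v : ℝ → E4} :
    IsDevelopment Γ x₀ v p ↔ ∃ P : ℝ → E4 →L[ℝ] E4,
      (p 0, P 0) = (x₀, ContinuousLinearMap.id ℝ E4) ∧
        IsControlledCurve (developmentField Γ) v fun t => (p t, P t) := by
  constructor
  · rintro ⟨h₀, P, hp, hP₀, hP⟩
    exact ⟨P, by rw [h₀, hP₀], fun t ht => (hp t ht).prodMk (hP t ht)⟩
  · rintro ⟨P, h₀, hy⟩
    exact ⟨congrArg Prod.fst h₀, P, fun t ht => hasDerivWithinAt_fst (hy t ht),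
      congrArg Prod.snd h₀, fun t ht => hasDerivWithinAt_snd (hy t ht)⟩

theorem contDiff_developmentField {n : WithTop ℕ∞} (hΓ : ContDiff ℝ n Γ) :
    ContDiff ℝ n (developmentField Γ) := by
  have hvel : ContDiff ℝ n fun q : (E4 × (E4 →L[ℝ] E4)) × E4 => q.1.2 q.2 :=
    contDiff_fst.snd.clm_apply contDiff_snd
  exact hvel.prodMk (((hΓ.comp contDiff_fst.fst).clm_apply hvel).clm_comp contDiff_fst.snd).neg

theorem fderiv_developmentField {x : E4} (hΓ : DifferentiableAt ℝ Γ x) (a ξ b : E4)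
    (P Q : E4 →L[ℝ] E4) :
    fderiv ℝ (developmentField Γ) ((x, P), a) ((ξ, Q), b) =
      (Q a + P b, -((fderiv ℝ Γ x ξ (P a) + Γ x (Q a + P b)).comp P + (Γ x (P a)).comp Q)) := by
  have hbase := (hasFDerivAt_fst (𝕜 := ℝ) (p := ((x, P), a))).fst
  have htrans := (hasFDerivAt_fst (𝕜 := ℝ) (p := ((x, P), a))).snd
  have hvel := htrans.clm_apply (hasFDerivAt_snd (𝕜 := ℝ) (p := ((x, P), a)))
  have hΓ' := HasFDerivAt.comp (g := Γ) ((x, P), a) hΓ.hasFDerivAt hbase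
  have hfield : HasFDerivAt (developmentField Γ) _ ((x, P), a) :=
    hvel.prodMk ((hΓ'.clm_apply hvel).clm_comp htrans).neg
  rw [hfield.fderiv]
  ext1
  · exact add_comm (P b) (Q a)
  · ext1 X
    change -(Γ x (P a) (Q X) + (Γ x (P b + Q a) + fderiv ℝ Γ x ξ (P a)) (P X)) =
      -((fderiv ℝ Γ x ξ (P a) + Γ x (Q a + P b)) (P X) + Γ x (P a) (Q X))
    rw [add_comm (P b), add_comm (Γ x _), add_comm (Γ x (P a) (Q X))]

theorem IsDevelopment.eqOn (hΓ : ContDiff ℝ 1 Γ) {x₀ : E4} {v p₁ p₂ : ℝ → E4}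
    (hv : ContinuousOn v (Icc 0 1)) (h₁ : IsDevelopment Γ x₀ v p₁)
    (h₂ : IsDevelopment Γ x₀ v p₂) : EqOn p₁ p₂ (Icc 0 1) := by
  obtain ⟨P₁, hP₁, hy₁⟩ := isDevelopment_iff.1 h₁
  obtain ⟨P₂, hP₂, hy₂⟩ := isDevelopment_iff.1 h₂
  exact fun t ht => congrArg Prod.fst <|
    hy₁.eqOn (contDiff_developmentField hΓ) hv hy₂ (hP₁.trans hP₂.symm) ht

theorem continuous_shift (u : C(I, E4)) (a : E4) : Continuous (shift u a) :=
  (u.continuous.comp continuous_projIcc).add continuous_const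

theorem exists_isParallelTranslation (hΓ : Continuous Γ) (hp : ContinuousOn p (Icc 0 1))
    (hq : ContinuousOn q (Icc 0 1)) : ∃ P : ℝ → E4 →L[ℝ] E4, IsParallelTranslation Γ p q P := by
  have hA : ContinuousOn (fun t => -ContinuousLinearMap.compL ℝ E4 E4 E4 (Γ (p t) (q t)))
      (Icc 0 1) :=
    ((ContinuousLinearMap.compL ℝ E4 E4 E4).continuous.comp_continuousOn
      ((hΓ.comp_continuousOn hp).clm_apply hq)).neg
  obtain ⟨P, hP₀, hP⟩ := exists_hasDerivWithinAt_linear ⟨_, hA.domRestrict⟩ (.id ℝ E4)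
  exact ⟨P, hP₀, fun t ht => (hP t ht).congr_deriv (by simp [IccExtend_of_mem _ _ ht])⟩

namespace IsFrameGeodesic

theorem continuousOn {T : ℝ} (hp : IsFrameGeodesic Γ T p q) : ContinuousOn p (Icc 0 T) :=
  fun t ht => (hp t ht).1.continuousWithinAt

theorem continuousOn_velocity {T : ℝ} (hp : IsFrameGeodesic Γ T p q) :
    ContinuousOn q (Icc 0 T) :=
  fun t ht => (hp t ht).2.continuousWithinAt

theorem eqOn_parallelTranslation (hΓ : Continuous Γ) (hp : IsFrameGeodesic Γ 1 p q)
    {P : ℝ → E4 →L[ℝ] E4} (hP : IsParallelTranslation Γ p q P) :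
    EqOn (fun t => P t (q 0)) q (Icc 0 1) := by
  have hw : ContinuousOn (fun t => -Γ (p t) (q t)) (Icc 0 1) :=
    ((hΓ.comp_continuousOn hp.continuousOn).clm_apply hp.continuousOn_velocity).neg
  refine IsControlledCurve.eqOn (F := fun z : E4 × (E4 →L[ℝ] E4) => z.2 z.1)
    (contDiff_snd.clm_apply contDiff_fst) hw (fun t ht => ?_) (fun t ht => ?_) (by simp [hP.1])
  · exact ((hP.2 t ht).clm_apply (hasDerivWithinAt_const t _ (q 0))).congr_deriv (by simp)
  · exact (hp t ht).2.congr_deriv (by simp)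

theorem exists_isControlledCurve (hΓ : Continuous Γ) (hp : IsFrameGeodesic Γ 1 p q) :
    ∃ P : ℝ → E4 →L[ℝ] E4, P 0 = .id ℝ E4 ∧ EqOn (fun t => P t (q 0)) q (Icc 0 1) ∧
      IsControlledCurve (developmentField Γ) (fun _ => q 0) fun t => (p t, P t) := by
  obtain ⟨P, hP⟩ := exists_isParallelTranslation hΓ hp.continuousOn hp.continuousOn_velocity
  have hPq := hp.eqOn_parallelTranslation hΓ hP
  refine ⟨P, hP.1, hPq, fun t ht => ((hp t ht).1.prodMk (hP.2 t ht)).congr_deriv ?_⟩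
  simp [developmentField, hPq ht]

end IsFrameGeodesic

/-- `ζ` is the variation of a geodesic, viewed as a development, when its control varies in the
constant direction `b`. -/
theorem isJacobiField_of_linearized (hΓ : Differentiable ℝ Γ) {P : ℝ → E4 →L[ℝ] E4}
    (hPq : EqOn (fun t => P t (q 0)) q (Icc 0 1))
    (hy : IsControlledCurve (developmentField Γ) (fun _ => q 0) fun t => (p t, P t))
    {ζ : ℝ → E4 × (E4 →L[ℝ] E4)} {b : E4}
    (hζ : ∀ t ∈ Icc (0 : ℝ) 1, HasDerivWithinAt ζ
      (fderiv ℝ (developmentField Γ) ((p t, P t), q 0) (ζ t, b)) (Icc 0 1) t) :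
    IsJacobiField Γ 1 p q (fun t => (ζ t).1) fun t => (ζ t).2 (q 0) + P t b := by
  intro t ht
  have hζt := hζ t ht
  rw [fderiv_developmentField (hΓ _)] at hζt
  refine ⟨hasDerivWithinAt_fst hζt,
    (((hasDerivWithinAt_snd hζt).clm_apply (hasDerivWithinAt_const t _ (q 0))).add
    ((hasDerivWithinAt_snd (hy t ht)).clm_apply (hasDerivWithinAt_const t _ b))).congr_deriv ?_⟩
  simp only [developmentField, map_zero, add_zero, neg_apply, add_apply,
    ContinuousLinearMap.comp_apply, show P t (q 0) = q t from hPq ht, map_add]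
  abel

theorem NotConjugateAlong.eq_zero_of_linearized (hconj : NotConjugateAlong Γ 1 p q)
    (hΓ : Differentiable ℝ Γ) {P : ℝ → E4 →L[ℝ] E4} (hP₀ : P 0 = .id ℝ E4)
    (hPq : EqOn (fun t => P t (q 0)) q (Icc 0 1))
    (hy : IsControlledCurve (developmentField Γ) (fun _ => q 0) fun t => (p t, P t))
    {ζ : ℝ → E4 × (E4 →L[ℝ] E4)} {b : E4} (hζ₀ : ζ 0 = 0) (hζ₁ : (ζ 1).1 = 0)
    (hζ : ∀ t ∈ Icc (0 : ℝ) 1, HasDerivWithinAt ζ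
      (fderiv ℝ (developmentField Γ) ((p t, P t), q 0) (ζ t, b)) (Icc 0 1) t) :
    b = 0 := by
  have h0 : (0 : ℝ) ∈ Icc (0 : ℝ) 1 := left_mem_Icc.2 zero_le_one
  have hjacobi := isJacobiField_of_linearized hΓ hPq hy hζ
  have hzero := hconj _ _ hjacobi (by simp [hζ₀]) hζ₁
  have hderiv := (hjacobi 0 h0).1.congr (fun t ht => (hzero t ht).symm) (hzero 0 h0).symm
  simpa [hζ₀, hP₀] using (uniqueDiffOn_Icc zero_lt_one 0 h0).eq_deriv _ hderiv
    (hasDerivWithinAt_const 0 _ (0 : E4))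

theorem IsFrameGeodesic.exists_hasStrictFDerivAt_development (hΓ : ContDiff ℝ 1 Γ)
    (hp : IsFrameGeodesic Γ 1 p q) (hconj : NotConjugateAlong Γ 1 p q) :
    ∃ (D : C(I, E4) × E4 → C(I, E4)) (D' : C(I, E4) × E4 →L[ℝ] C(I, E4)),
      HasStrictFDerivAt D D' (0, q 0) ∧ (∀ t, D (0, q 0) t = p t) ∧
      (∀ᶠ z in 𝓝 (0, q 0),
        IsDevelopment Γ (p 0) (shift z.1 z.2) (IccExtend zero_le_one (D z))) ∧
      ((ContinuousMap.evalCLM ℝ 1 ∘L D') ∘L .inr ℝ C(I, E4) E4).IsInvertible := by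
  obtain ⟨P, hP₀, hPq, hy⟩ := hp.exists_isControlledCurve hΓ.continuous
  set y : C(I, E4 × (E4 →L[ℝ] E4)) := ⟨_, hy.continuousOn.domRestrict⟩
  have hy_eq : ∀ t ∈ Icc (0 : ℝ) 1, IccExtend zero_le_one y t = (p t, P t) := fun t ht =>
    IccExtend_of_mem _ _ ht
  have hyI : IsControlledCurve (developmentField Γ)
      (IccExtend zero_le_one (.const I (q 0) : C(I, E4))) (IccExtend zero_le_one y) := by
    intro t ht
    rw [hy_eq t ht]
    exact (hy t ht).congr hy_eq (hy_eq t ht)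
  obtain ⟨Y, Y', hY, hYy, hYcurve, hY'⟩ :=
    exists_hasStrictFDerivAt_controlledCurve (contDiff_developmentField hΓ) hyI
  set shiftMap : C(I, E4) × E4 →L[ℝ] C(I, E4) := (ContinuousLinearMap.id ℝ _).coprod (.const ℝ I)
  have hshift (z : C(I, E4) × E4) : IccExtend zero_le_one (shiftMap z) = shift z.1 z.2 := by
    ext1 t
    simp [shiftMap, shift, IccExtend]
  have hshift₀ : shiftMap (0, q 0) = .const I (q 0) := by ext1 t; simp [shiftMap]
  set base := (ContinuousLinearMap.fst ℝ E4 (E4 →L[ℝ] E4)).compLeftContinuous ℝ I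
  refine ⟨fun z => base (Y (shiftMap z)), base ∘L Y' ∘L shiftMap, ?_, fun t => ?_, ?_, ?_⟩
  · rw [← hshift₀] at hY
    exact base.hasStrictFDerivAt.comp _ (hY.comp _ shiftMap.hasStrictFDerivAt)
  · simp [base, hshift₀, hYy, y]
  · have hnear := shiftMap.continuous.continuousAt.tendsto.eventually (hshift₀ ▸ hYcurve)
    filter_upwards [hnear] with z hz
    rw [hshift] at hz
    refine isDevelopment_iff.2 ⟨fun t => (IccExtend zero_le_one (Y (shiftMap z)) t).2, ?_, hz.2⟩
    simpa [hP₀, y, base] using hz.1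
  · refine isInvertible_of_injective rfl <| (injective_iff_map_eq_zero _).2 fun b hb => ?_
    refine hconj.eq_zero_of_linearized (hΓ.differentiable one_ne_zero) hP₀ hPq hy
      (ζ := IccExtend zero_le_one (Y' (shiftMap (0, b)))) ?_ ?_ fun t ht => ?_
    · simpa using (hY' (shiftMap (0, b))).1
    · simpa [base] using hb
    · have hconst : IccExtend zero_le_one (Function.const I (q 0)) t = q 0 := rfl
      simpa [hy_eq t ht, hshift, shift, hconst] using (hY' (shiftMap (0, b))).2 t ht

theorem IsDevelopment.developsTo_iff (hΓ : ContDiff ℝ 1 Γ) {x₀ x₁ a : E4} {u : C(I, E4)}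
    (hp : IsDevelopment Γ x₀ (shift u a) p) : DevelopsTo Γ x₀ x₁ u a ↔ p 1 = x₁ := by
  refine ⟨fun ⟨c, hc, hc₁⟩ => ?_, fun hp₁ => ⟨p, hp, hp₁⟩⟩
  rw [← hc₁]
  exact hp.eqOn hΓ (continuous_shift u a).continuousOn hc (right_mem_Icc.2 zero_le_one)

theorem IsFrameGeodesic.exists_developsTo_iff (hΓ : ContDiff ℝ 1 Γ)
    (hp : IsFrameGeodesic Γ 1 p q) (hconj : NotConjugateAlong Γ 1 p q) {U : Set E4}
    (hU : IsOpen U) (hpU : ∀ t ∈ Icc (0 : ℝ) 1, p t ∈ U) :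
    ∃ κ : C(I, E4) → E4, Tendsto κ (𝓝 0) (𝓝 (q 0)) ∧ (∃ s ∈ 𝓝 0, ContinuousOn κ s) ∧
      ∀ᶠ z : C(I, E4) × E4 in 𝓝 (0, q 0), (DevelopsTo Γ (p 0) (p 1) z.1 z.2 ↔ κ z.1 = z.2) ∧
        ∀ c, IsDevelopment Γ (p 0) (shift z.1 z.2) c → MapsTo c (Icc 0 1) U := by
  obtain ⟨D, D', hD, hDp, hdev, hinv⟩ := hp.exists_hasStrictFDerivAt_development hΓ hconj
  have hend := (ContinuousMap.evalCLM ℝ (1 : I)).hasStrictFDerivAt.comp (0, q 0) hD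
  have hDU : ∀ᶠ z in 𝓝 (0, q 0), MapsTo (D z) univ U :=
    hD.continuousAt.eventually_mem <|
      (ContinuousMap.isOpen_setOfPred_mapsTo isCompact_univ hU).mem_nhds
        fun t _ => by rw [hDp]; exact hpU t t.2
  obtain ⟨K, s, hs, hlip⟩ :=
    (hend.hasStrictFDerivAt_implicitFunctionOfProdDomain hinv).exists_lipschitzOnWith
  refine ⟨_, hend.tendsto_implicitFunctionOfProdDomain hinv, ⟨s, hs, hlip.continuousOn⟩, ?_⟩
  filter_upwards [hend.eventually_apply_eq_iff_implicitFunctionOfProdDomain hinv, hdev, hDU]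
    with z hz hdev_z hDz
  constructor
  · rw [← hz, hdev_z.developsTo_iff hΓ]
    simp [hDp, IccExtend_right]
  · intro c hc t ht
    rw [hc.eqOn hΓ (continuous_shift _ _).continuousOn hdev_z ht, IccExtend_of_mem _ _ ht]
    exact hDz (mem_univ _)

theorem IsFrameGeodesic.exists_isAdmissible (hΓ : ContDiff ℝ 1 Γ) {g h : FormField}
    (hh : IsRiemannianMetric h) (hp : IsFrameGeodesic Γ 1 p q)
    (hconj : NotConjugateAlong Γ 1 p q) (hcone : g (p 0) (q 0) (q 0) < 0) {U : Set E4}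
    (hU : IsOpen U) (hpU : ∀ t ∈ Icc (0 : ℝ) 1, p t ∈ U) :
    ∃ (ε C : ℝ) (W : Set E4) (κ : C(I, E4) → E4),
      IsAdmissible Γ g h (p 0) (p 1) (q 0) ε C W κ ∧ DevelopmentsIn Γ h (p 0) ε κ U := by
  obtain ⟨κ, hκ, ⟨s, hs, hκs⟩, hκdev⟩ := hp.exists_developsTo_iff hΓ hconj hU hpU
  obtain ⟨s', hs', W', hW', hgood⟩ := mem_nhds_prod_iff.1 hκdev
  have hcone' : ∀ᶠ a in 𝓝 (q 0), g (p 0) a a < 0 :=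
    ContinuousAt.eventually_lt (f := fun a => g (p 0) a a) (by fun_prop) continuousAt_const hcone
  set W := W' ∩ {a | g (p 0) a a < 0} ∩ Metric.closedBall (q 0) 1
  have hW : W ∈ 𝓝 (q 0) :=
    inter_mem (inter_mem hW' hcone') (Metric.closedBall_mem_nhds _ one_pos)
  have hWb : Bornology.IsBounded W := Metric.isBounded_closedBall.subset inter_subset_right
  obtain ⟨L, hL⟩ := hh.exists_equiv_norm_eq_rnorm (p 0)
  obtain ⟨C, hC⟩ := (L.lipschitz.isBounded_image hWb).exists_norm_le
  obtain ⟨ε, hε, hball⟩ :=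
    hh.exists_curveBall_subset (p 0) (inter_mem (inter_mem hs hs') (hκ.eventually_mem hW))
  have hmem : ∀ u ∈ curveBall h (p 0) ε, κ u ∈ W := fun u hu => (hball hu).2
  have hsol : ∀ u ∈ curveBall h (p 0) ε, ∀ a ∈ W,
      (DevelopsTo Γ (p 0) (p 1) u a ↔ κ u = a) ∧
        ∀ c, IsDevelopment Γ (p 0) (shift u a) c → MapsTo c (Icc 0 1) U :=
    fun u hu a ha => hgood (mk_mem_prod (hball hu).1.2 ha.1.1)
  refine ⟨ε, C, W, κ, ?_, fun u hu c hc t ht => (hsol u hu _ (hmem u hu)).2 c hc ht⟩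
  exact
    { eps_pos := hε
      nhds := hW
      bounded := hWb
      mem := hmem
      develops := fun u hu => (hsol u hu _ (hmem u hu)).1.2 rfl
      unique := fun u hu a ha hdev => ((hsol u hu a ha).1.1 hdev).symm
      continuousOn := hκs.mono fun u hu => (hball hu).1.1
      timelike := fun u hu => (hmem u hu).1.2
      norm_le := fun u hu => (hL _).symm.trans_le (hC _ (mem_image_of_mem L (hmem u hu))) }

end Development

section FixedPointCurve

open unitInterval

theorem isCompact_setOf_lipschitzWith {α E : Type*} [PseudoMetricSpace α] [CompactSpace α]
    [MetricSpace E] [ProperSpace E] (K : NNReal) (a : α) (b : E) :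
    IsCompact {f : C(α, E) | f a = b ∧ LipschitzWith K f} := by
  refine ArzelaAscoli.isCompact_of_equicontinuous _ ?_
    (LipschitzWith.uniformEquicontinuous _ K fun f => f.2.2).equicontinuous
  have himage : ContinuousMap.toFun '' {f : C(α, E) | f a = b ∧ LipschitzWith K f} =
      {f : α → E | f a = b ∧ LipschitzWith K f} := by
    ext f
    exact ⟨by rintro ⟨f, hf, rfl⟩; exact hf, fun hf => ⟨⟨f, hf.2.continuous⟩, hf, rfl⟩⟩
  rw [himage]
  refine (isCompact_univ_pi fun x => isCompact_closedBall b (K * dist x a)).of_isClosed_subset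
    ((isClosed_eq (continuous_apply a) continuous_const).inter (isClosed_setOfPred_lipschitzWith K))
    fun f hf x _ => ?_
  simpa [hf.1] using hf.2.dist_le_mul x a

theorem norm_le_of_lipschitzWith {X : Type*} [NormedAddCommGroup X] {ε : NNReal} {y : C(I, X)}
    (hy₀ : y 0 = 0) (hy : LipschitzWith ε y) : ‖y‖ ≤ ε := by
  refine (ContinuousMap.norm_le _ ε.2).2 fun t => ?_
  calc ‖y t‖ = dist (y t) (y 0) := by rw [hy₀, dist_zero_right]
    _ ≤ ε * dist t 0 := hy.dist_le_mul t 0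
    _ ≤ ε := mul_le_of_le_one_right ε.2 (by
        rw [Subtype.dist_eq, Icc.coe_zero, Real.dist_0_eq_abs, abs_of_nonneg t.2.1]
        exact t.2.2)

variable {X : Type*} [NormedAddCommGroup X] [NormedSpace ℝ X]

theorem convex_setOf_lipschitzWith {α : Type*} [PseudoMetricSpace α] (K : NNReal) (a : α) :
    Convex ℝ {f : C(α, X) | f a = 0 ∧ LipschitzWith K f} := by
  rintro f ⟨hfa, hf⟩ g ⟨hga, hg⟩ r s hr hs hrs
  refine ⟨by simp [hfa, hga], LipschitzWith.of_dist_le_mul fun x y => ?_⟩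
  calc dist ((r • f + s • g) x) ((r • f + s • g) y)
      ≤ dist (r • f x) (r • f y) + dist (s • g x) (s • g y) := dist_add_add_le _ _ _ _
    _ = r * dist (f x) (f y) + s * dist (g x) (g y) := by
        rw [dist_smul₀, dist_smul₀, Real.norm_of_nonneg hr, Real.norm_of_nonneg hs]
    _ ≤ r * (K * dist x y) + s * (K * dist x y) := by
        gcongr
        exacts [hf.dist_le_mul x y, hg.dist_le_mul x y]
    _ = K * dist x y := by rw [← add_mul, hrs, one_mul]

theorem lipschitzWith_primitive (y : C(I, X)) : LipschitzWith ‖y‖₊ (primitive y) := by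
  refine LipschitzWith.of_dist_le_mul fun t s => ?_
  have hint (a b : ℝ) : IntervalIntegrable (IccExtend zero_le_one y) MeasureTheory.volume a b :=
    (y.continuous.Icc_extend' (h := zero_le_one)).intervalIntegrable a b
  rw [dist_eq_norm, primitive_apply, primitive_apply,
    intervalIntegral.integral_interval_sub_left (hint _ _) (hint _ _)]
  exact intervalIntegral.norm_integral_le_of_norm_le_const fun _ _ => y.norm_coe_le_norm _

theorem exists_primitive_eq_of_mapsTo_closedBall [ProperSpace X] {Φ : C(I, X) → C(I, X)}
    {ε : NNReal} (hΦ : ContinuousOn Φ (Metric.closedBall 0 ε))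
    (hmaps : MapsTo Φ (Metric.closedBall 0 ε) (Metric.closedBall 0 ε)) :
    ∃ y ∈ Metric.closedBall 0 (ε : ℝ), primitive (Φ y) = y := by
  have hsub : {y : C(I, X) | y 0 = 0 ∧ LipschitzWith ε y} ⊆ Metric.closedBall 0 ε :=
    fun y hy => mem_closedBall_zero_iff.2 (norm_le_of_lipschitzWith hy.1 hy.2)
  obtain ⟨y, hy, hfix⟩ := schauder_fixedPoint (f := fun y => primitive (Φ y))
    (isCompact_setOf_lipschitzWith ε (0 : I) (0 : X)) (convex_setOf_lipschitzWith ε 0)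
    ⟨0, rfl, LipschitzWith.const' 0⟩
    (primitive.continuous.comp_continuousOn (hΦ.mono hsub)) fun y hy =>
      ⟨primitive_apply_zero _, (lipschitzWith_primitive _).weaken <|
        mem_closedBall_zero_iff.1 (hmaps (hsub hy))⟩
  exact ⟨y, hsub hy, hfix⟩

theorem exists_continuousOn_controlledCurve {X V : Type*} [NormedAddCommGroup X]
    [NormedSpace ℝ X] [CompleteSpace X] [NormedAddCommGroup V] [NormedSpace ℝ V] [CompleteSpace V]
    {F : X × V → X} (hF : ContDiff ℝ 1 F) {x₀ : X} {S : Set C(I, V)}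
    (hS : ∀ v ∈ S, ∃ y : ℝ → X, y 0 = x₀ ∧ IsControlledCurve F (IccExtend zero_le_one v) y) :
    ∃ Y : C(I, V) → C(I, X), ContinuousOn Y S ∧ ∀ v ∈ S, Y v 0 = x₀ ∧
      IsControlledCurve F (IccExtend zero_le_one v) (IccExtend zero_le_one (Y v)) := by
  have hexists (v : C(I, V)) : ∃ y : C(I, X), v ∈ S → y 0 = x₀ ∧
      IsControlledCurve F (IccExtend zero_le_one v) (IccExtend zero_le_one y) := by
    by_cases hv : v ∈ S
    · obtain ⟨y, hy₀, hy⟩ := hS v hv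
      have hyc : ContinuousOn y I := fun t ht => (hy t ht).continuousWithinAt
      have heq : EqOn (IccExtend zero_le_one (⟨_, hyc.domRestrict⟩ : C(I, X))) y I :=
        fun t ht => IccExtend_of_mem zero_le_one _ ht
      exact ⟨⟨_, hyc.domRestrict⟩, fun _ => ⟨hy₀, fun t ht => by
        simpa only [heq ht] using (hy t ht).congr heq (heq ht)⟩⟩
    · exact ⟨0, fun h => absurd h hv⟩
  choose Y hY using hexists
  refine ⟨Y, fun v hv => ?_, hY⟩
  obtain ⟨Z, Z', hZ, hZv, hZcurve, -⟩ := exists_hasStrictFDerivAt_controlledCurve hF (hY v hv).2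
  have hYZ : ∀ᶠ w in 𝓝[S] v, Y w = Z w := by
    filter_upwards [hZcurve.filter_mono nhdsWithin_le_nhds, self_mem_nhdsWithin] with w hw hwS
    have heq := (hY w hwS).2.eqOn hF (w.continuous.Icc_extend' (h := zero_le_one)).continuousOn
      hw.2 (by simpa [IccExtend_of_mem] using ((hY w hwS).1.trans (hY v hv).1.symm).trans hw.1.symm)
    ext1 t
    simpa [IccExtend_val] using heq t.2
  exact hZ.continuousAt.continuousWithinAt.congr_of_eventuallyEq hYZ hZv.symm

theorem exists_continuousOn_comp {α Y Z : Type*} [TopologicalSpace α] [TopologicalSpace Y]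
    [TopologicalSpace Z] [Nonempty Z] {f : Y → Z} {s : Set Y} (hf : ContinuousOn f s) :
    ∃ Φ : C(α, Y) → C(α, Z), ContinuousOn Φ {y | ∀ a, y a ∈ s} ∧
      ∀ y, (∀ a, y a ∈ s) → ∀ a, Φ y a = f (y a) := by
  classical
  let coe : C(s, Y) := ⟨Subtype.val, continuous_subtype_val⟩
  let lift (y : {y : C(α, Y) | ∀ a, y a ∈ s}) : C(α, s) :=
    ⟨fun a => ⟨y.1 a, y.2 a⟩, y.1.continuous.subtype_mk y.2⟩
  have hlift : Continuous lift :=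
    (coe.isInducing_postcomp .subtypeVal).continuous_iff.2 continuous_subtype_val
  let Φ (y : C(α, Y)) : C(α, Z) :=
    if hy : ∀ a, y a ∈ s then (⟨_, hf.domRestrict⟩ : C(s, Z)).comp (lift ⟨y, hy⟩)
    else .const α (Classical.arbitrary Z)
  refine ⟨Φ, continuousOn_iff_continuous_domRestrict.2 ?_, fun y hy a => ?_⟩
  · convert (ContinuousMap.continuous_postcomp (⟨_, hf.domRestrict⟩ : C(s, Z))).comp hlift
    ext1 y
    exact dif_pos y.2
  · simp [Φ, hy, lift]

end FixedPointCurve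

section Gravity

set_option maxSynthPendingDepth 3

variable {Γ : ConnectionField} {g h : FormField}

theorem koszul_smul (x : E4) (c : ℝ) (X : E4) :
    koszul g x (c • X) (c • X) = c ^ 2 • koszul g x X X := by
  ext Z
  simp [koszul]
  ring

theorem christoffel_smul (x : E4) (c : ℝ) (X : E4) :
    christoffel g x (c • X) (c • X) = c ^ 2 • christoffel g x X X := by
  rw [christoffel, koszul_smul, map_smul, christoffel]

theorem gravTensor_smul (x : E4) (c : ℝ) (X : E4) :
    gravTensor Γ g x (c • X) (c • X) = c ^ 2 • gravTensor Γ g x X X := by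
  simp only [gravTensor, christoffel_smul, map_smul, smul_apply, smul_sub, smul_smul, sq]

theorem continuous_gravTensor (x : E4) : Continuous fun X => gravTensor Γ g x X X := by
  have hkoszul : Continuous fun X => koszul g x X X :=
    continuous_clm_apply.2 fun Z => by simp only [koszul, smul_apply, add_apply, sub_apply,
      ContinuousLinearMap.flip_apply]; fun_prop
  unfold gravTensor christoffel
  fun_prop

theorem continuousOn_inverse_isInvertible {X Y : Type*} [NormedAddCommGroup X] [NormedSpace ℝ X]
    [CompleteSpace X] [NormedAddCommGroup Y] [NormedSpace ℝ Y] :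
    ContinuousOn (ContinuousLinearMap.inverse : (X →L[ℝ] Y) → (Y →L[ℝ] X))
      {A | A.IsInvertible} := fun _ hA =>
  (ContinuousLinearMap.IsInvertible.contDiffAt_map_inverse (n := 0) hA).continuousAt
    |>.continuousWithinAt

theorem continuousOn_christoffel {O : Set E4} (hO : IsOpen O) (hg : ContDiffOn ℝ 1 g O)
    (hinv : ∀ x ∈ O, (g x).IsInvertible) :
    ContinuousOn (fun q : E4 × E4 => christoffel g q.1 q.2 q.2) (O ×ˢ univ) := by
  have hfst : MapsTo (Prod.fst : E4 × E4 → E4) (O ×ˢ univ) O := fun q hq => hq.1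
  have hderiv : ContinuousOn (fun q : E4 × E4 => fderiv ℝ g q.1) (O ×ˢ univ) :=
    (hg.continuousOn_fderiv_of_isOpen hO le_rfl).comp continuousOn_fst hfst
  have hkoszul : ContinuousOn (fun q : E4 × E4 => koszul g q.1 q.2 q.2) (O ×ˢ univ) :=
    continuousOn_clm_apply.2 fun Z => by
      simp only [koszul, smul_apply, add_apply, sub_apply, ContinuousLinearMap.flip_apply]
      fun_prop
  exact (continuousOn_inverse_isInvertible.comp (hg.continuousOn.comp continuousOn_fst hfst)
    fun q hq => hinv _ hq.1).clm_apply hkoszul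

theorem IsRiemannianMetric.rnorm_gravTensor_le (hh : IsRiemannianMetric h) (x X : E4) :
    rnorm h x (gravTensor Γ g x X X) ≤ gravNorm Γ g h x * rnorm h x X ^ 2 := by
  obtain ⟨L, hL⟩ := hh.exists_equiv_norm_eq_rnorm x
  have hbounded :
      BddAbove ((fun X => rnorm h x (gravTensor Γ g x X X)) '' {X | rnorm h x X ≤ 1}) := by
    have hball : {X | rnorm h x X ≤ 1} = L.toHomeomorph ⁻¹' Metric.closedBall 0 1 := by
      ext Y; simp [← hL]
    rw [hball]
    simp only [← hL]
    exact (L.toHomeomorph.isCompact_preimage.2 (isCompact_closedBall 0 1)).bddAbove_image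
      (L.continuous.comp (continuous_gravTensor x)).norm.continuousOn
  rcases eq_or_ne X 0 with rfl | hX
  · have hzero : gravTensor Γ g x 0 0 = 0 := by simpa using gravTensor_smul x 0 0
    simp [hzero, rnorm]
  have hpos : 0 < rnorm h x X := by rw [← hL]; simpa using hX
  have hunit : rnorm h x ((rnorm h x X)⁻¹ • X) ≤ 1 := by
    rw [rnorm_smul, abs_of_pos (inv_pos.2 hpos), inv_mul_cancel₀ hpos.ne']
  have hle := le_csSup hbounded (mem_image_of_mem _ hunit)
  rw [gravTensor_smul, rnorm_smul, abs_of_nonneg (sq_nonneg _), inv_pow,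
    inv_mul_le_iff₀ (by positivity)] at hle
  rwa [mul_comm]

end Gravity

section Geodesic

set_option maxSynthPendingDepth 3

open unitInterval

variable {Γ : ConnectionField} {g h : FormField} {p q : ℝ → E4}

theorem eqOn_const_of_hasDerivWithinAt_zero {X : Type*} [NormedAddCommGroup X] [NormedSpace ℝ X]
    {f : ℝ → X} {a b : ℝ} (hf : ∀ t ∈ Icc a b, HasDerivWithinAt f 0 (Icc a b) t) :
    EqOn f (fun _ => f a) (Icc a b) :=
  constant_of_derivWithin_zero (fun t ht => (hf t ht).differentiableWithinAt) fun t ht =>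
    (hf t (Ico_subset_Icc_self ht)).derivWithin
      (uniqueDiffOn_Icc (ht.1.trans_lt ht.2) t (Ico_subset_Icc_self ht))

theorem IsMetricConnection.eqOn_apply_parallelTranslation (hΓh : IsMetricConnection Γ h)
    (hh : Differentiable ℝ h) (hp : ∀ t ∈ Icc (0 : ℝ) 1, HasDerivWithinAt p (q t) (Icc 0 1) t)
    {P : ℝ → E4 →L[ℝ] E4} (hP : IsParallelTranslation Γ p q P) (X : E4) :
    EqOn (fun t => h (p t) (P t X) (P t X)) (fun _ => h (p 0) X X) (Icc 0 1) := by
  have hconst : EqOn (fun t => h (p t) (P t X) (P t X)) _ (Icc 0 1) :=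
    eqOn_const_of_hasDerivWithinAt_zero fun t ht => ?_
  · simpa [hP.1] using hconst
  have hmetric : HasDerivWithinAt (fun t => h (p t)) (fderiv ℝ h (p t) (q t)) (Icc 0 1) t :=
    (hh (p t)).hasFDerivAt.comp_hasDerivWithinAt t (hp t ht)
  have hvector := (hP.2 t ht).clm_apply (hasDerivWithinAt_const t _ X)
  refine ((hmetric.clm_apply hvector).clm_apply hvector).congr_deriv ?_
  simp only [add_apply, map_zero, add_zero, map_neg, neg_apply,
    ContinuousLinearMap.comp_apply, hΓh (p t) (P t X) (P t X) (q t)]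
  ring

theorem eqOn_apply_velocity_of_solvesGeodesicEq {T : ℝ}
    (hg : ∀ t ∈ Icc 0 T, DifferentiableAt ℝ g (p t))
    (hinv : ∀ t ∈ Icc 0 T, (g (p t)).IsInvertible)
    (hsymm : ∀ t ∈ Icc 0 T, ∀ X Y, g (p t) X Y = g (p t) Y X)
    (hp : ∀ t ∈ Icc 0 T, SolvesGeodesicEq (christoffel g) (Icc 0 T) p q t) :
    EqOn (fun t => g (p t) (q t) (q t)) (fun _ => g (p 0) (q 0) (q 0)) (Icc 0 T) := by
  refine eqOn_const_of_hasDerivWithinAt_zero fun t ht => ?_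
  have hmetric : HasDerivWithinAt (fun t => g (p t)) (fderiv ℝ g (p t) (q t)) (Icc 0 T) t :=
    (hg t ht).hasFDerivAt.comp_hasDerivWithinAt t (hp t ht).1
  refine ((hmetric.clm_apply (hp t ht).2).clm_apply (hp t ht).2).congr_deriv ?_
  simp only [add_apply, map_neg, neg_apply, hsymm t ht (q t),
    christoffel_spec g (p t) (q t) (q t) (q t) (hinv t ht)]
  ring

/-- The derivative `P⁻¹ G_p(P v, P v)` which the control `v` must have, as a function of
`((p, P), v)`, for the development `p = S v` to be a geodesic of the Levi-Civita connection; here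
`P` is the parallel translation along `p`. -/
noncomputable def pulledBackForce (Γ : ConnectionField) (g : FormField)
    (z : (E4 × (E4 →L[ℝ] E4)) × E4) : E4 :=
  z.1.2.inverse (gravTensor Γ g z.1.1 (z.1.2 z.2) (z.1.2 z.2))

theorem continuousOn_pulledBackForce (hΓ : Continuous Γ) {O : Set E4} (hO : IsOpen O)
    (hg : ContDiffOn ℝ 1 g O) (hinv : ∀ x ∈ O, (g x).IsInvertible) :
    ContinuousOn (pulledBackForce Γ g) {z | z.1.1 ∈ O ∧ z.1.2.IsInvertible} := by
  have hvel : Continuous fun z : (E4 × (E4 →L[ℝ] E4)) × E4 => z.1.2 z.2 :=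
    continuous_fst.snd.clm_apply continuous_snd
  have hchristoffel := (continuousOn_christoffel hO hg hinv).comp
    (continuous_fst.fst.prodMk hvel).continuousOn
    fun (z : (E4 × (E4 →L[ℝ] E4)) × E4) (hz : z.1.1 ∈ O ∧ z.1.2.IsInvertible) => ⟨hz.1, mem_univ _⟩
  have hforce : Continuous fun z : (E4 × (E4 →L[ℝ] E4)) × E4 => Γ z.1.1 (z.1.2 z.2) (z.1.2 z.2) :=
    ((hΓ.comp continuous_fst.fst).clm_apply hvel).clm_apply hvel
  exact (continuousOn_inverse_isInvertible.comp continuous_fst.snd.continuousOn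
    fun z hz => hz.2).clm_apply (hforce.continuousOn.sub hchristoffel)

theorem IsRiemannianMetric.isInvertible_of_isometry (hh : IsRiemannianMetric h) {x y : E4}
    {P : E4 →L[ℝ] E4} (hP : ∀ X, h y (P X) (P X) = h x X X) : P.IsInvertible := by
  refine isInvertible_of_injective rfl ((injective_iff_map_eq_zero P).2 fun X hX => ?_)
  by_contra hne
  simpa [← hP X, hX] using hh.pos x X hne

theorem IsRiemannianMetric.rnorm_pulledBackForce_le (hh : IsRiemannianMetric h) {x y : E4}
    {P : E4 →L[ℝ] E4} (hP : ∀ X, h y (P X) (P X) = h x X X) (a : E4) :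
    rnorm h x (pulledBackForce Γ g ((y, P), a)) ≤ gravNorm Γ g h y * rnorm h x a ^ 2 := by
  have hnorm (X : E4) : rnorm h x X = rnorm h y (P X) := by rw [rnorm, rnorm, hP]
  rw [hnorm, hnorm, pulledBackForce, (hh.isInvertible_of_isometry hP).self_apply_inverse]
  exact hh.rnorm_gravTensor_le y (P a)

theorem IsControlledCurve.isometry (hΓh : IsMetricConnection Γ h) (hh : Differentiable ℝ h)
    {x₀ : E4} {v : ℝ → E4} {Y : C(I, E4 × (E4 →L[ℝ] E4))}
    (hY : IsControlledCurve (developmentField Γ) v (IccExtend zero_le_one Y))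
    (hY₀ : Y 0 = (x₀, .id ℝ E4)) (t : I) (X : E4) :
    h (Y t).1 ((Y t).2 X) ((Y t).2 X) = h x₀ X X := by
  have hiso := hΓh.eqOn_apply_parallelTranslation hh
    (fun s hs => hasDerivWithinAt_fst (hY s hs))
    ⟨by simp [hY₀], fun s hs => hasDerivWithinAt_snd (hY s hs)⟩ X t.2
  simpa [hY₀] using hiso

theorem DevelopmentsIn.frame_mem {x₀ : E4} {ε : ℝ} {κ : C(I, E4) → E4} {V : Set E4}
    (hV : DevelopmentsIn Γ h x₀ ε κ V) {u : C(I, E4)} (hu : u ∈ curveBall h x₀ ε)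
    {Y : C(I, E4 × (E4 →L[ℝ] E4))} (hY₀ : Y 0 = (x₀, .id ℝ E4))
    (hY : IsControlledCurve (developmentField Γ) (shift u (κ u)) (IccExtend zero_le_one Y))
    (t : I) : (Y t).1 ∈ V := by
  simpa using hV u hu (fun t => (IccExtend zero_le_one Y t).1)
    (isDevelopment_iff.2 ⟨fun t => (IccExtend zero_le_one Y t).2, by simpa using hY₀, hY⟩) t t.2

theorem IsControlledCurve.solvesGeodesicEq {P : ℝ → E4 →L[ℝ] E4} {v : ℝ → E4}
    (hy : IsControlledCurve (developmentField Γ) v fun t => (p t, P t)) {t : ℝ} (ht : t ∈ I)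
    (hP : (P t).IsInvertible)
    (hv : HasDerivWithinAt v (pulledBackForce Γ g ((p t, P t), v t)) I t) :
    SolvesGeodesicEq (christoffel g) I p (fun t => P t (v t)) t := by
  refine ⟨hasDerivWithinAt_fst (hy t ht),
    ((hasDerivWithinAt_snd (hy t ht)).clm_apply hv).congr_deriv ?_⟩
  simp only [developmentField, pulledBackForce, hP.self_apply_inverse, gravTensor, neg_apply,
    ContinuousLinearMap.comp_apply]
  abel

theorem IsRiemannianMetric.exists_primitive_eq (hh : IsRiemannianMetric h) (x₀ : E4) {ε : ℝ}
    (hε : 0 ≤ ε) {Φ : C(I, E4) → C(I, E4)} (hΦ : ContinuousOn Φ (curveBall h x₀ ε))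
    (hmaps : MapsTo Φ (curveBall h x₀ ε) (curveBall h x₀ ε)) :
    ∃ u ∈ curveBall h x₀ ε, primitive (Φ u) = u := by
  lift ε to NNReal using hε
  obtain ⟨L, hL⟩ := hh.exists_equiv_norm_eq_rnorm x₀
  let Λ := L.toContinuousLinearMap.compLeftContinuous ℝ I
  let Λ' := L.symm.toContinuousLinearMap.compLeftContinuous ℝ I
  have hΛΛ' (w : C(I, E4)) : Λ (Λ' w) = w := by ext1 t; exact L.apply_symm_apply (w t)
  have hprim (w : C(I, E4)) : primitive (Λ' w) = Λ' (primitive w) := by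
    ext1 t
    simp only [primitive_apply]
    exact L.symm.toContinuousLinearMap.intervalIntegral_comp_comm
      ((w.continuous.Icc_extend' (h := zero_le_one)).intervalIntegrable _ _)
  have hball : MapsTo Λ' (Metric.closedBall 0 ε) (curveBall h x₀ ε) := fun w hw =>
    (mem_curveBall_iff hL _).2 (by rwa [← hΛΛ' w] at hw)
  obtain ⟨w, hw, hfix⟩ := exists_primitive_eq_of_mapsTo_closedBall (Φ := fun w => Λ (Φ (Λ' w)))
    (Λ.continuous.comp_continuousOn (hΦ.comp Λ'.continuous.continuousOn hball))
    fun w hw => (mem_curveBall_iff hL _).1 (hmaps (hball hw))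
  have hΛ'Λ (w : C(I, E4)) : Λ' (Λ w) = w := by ext1 t; exact L.symm_apply_apply (w t)
  exact ⟨Λ' w, hball hw, by rw [← hΛ'Λ (Φ (Λ' w)), hprim, hfix]⟩

variable {x₀ x₁ X₀ : E4} {ε C : ℝ} {W : Set E4} {κ : C(I, E4) → E4}

namespace IsAdmissible

theorem rnorm_shift_le (hκ : IsAdmissible Γ g h x₀ x₁ X₀ ε C W κ) (hh : IsRiemannianMetric h)
    {u : C(I, E4)} (hu : u ∈ curveBall h x₀ ε) (t : ℝ) :
    rnorm h x₀ (shift u (κ u) t) ≤ ε + C := by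
  obtain ⟨L, hL⟩ := hh.exists_equiv_norm_eq_rnorm x₀
  rw [shift, ← hL, map_add]
  exact norm_add_le_of_le ((hL _).trans_le (hu _)) ((hL _).trans_le (hκ.norm_le u hu))

theorem exists_continuousOn_frame (hκ : IsAdmissible Γ g h x₀ x₁ X₀ ε C W κ)
    (hΓ : ContDiff ℝ 1 Γ) :
    ∃ Y : C(I, E4) → C(I, E4 × (E4 →L[ℝ] E4)), ContinuousOn Y (curveBall h x₀ ε) ∧
      ∀ u ∈ curveBall h x₀ ε, Y u 0 = (x₀, .id ℝ E4) ∧ (Y u 1).1 = x₁ ∧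
        IsControlledCurve (developmentField Γ) (shift u (κ u)) (IccExtend zero_le_one (Y u)) := by
  have hcontrol : ContinuousOn (fun u => u + ContinuousMap.const I (κ u)) (curveBall h x₀ ε) :=
    continuousOn_id.add (ContinuousMap.continuous_const'.comp_continuousOn hκ.continuousOn)
  obtain ⟨Y, hYc, hY⟩ := exists_continuousOn_controlledCurve (contDiff_developmentField hΓ)
    (S := (fun u => u + ContinuousMap.const I (κ u)) '' curveBall h x₀ ε)
    (x₀ := (x₀, .id ℝ E4)) <| by
      rintro _ ⟨u, hu, rfl⟩
      obtain ⟨p, hp, -⟩ := hκ.develops u hu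
      obtain ⟨P, h₀, hy⟩ := isDevelopment_iff.1 hp
      exact ⟨_, h₀, hy⟩
  refine ⟨_, hYc.comp hcontrol (mapsTo_image _ _), fun u hu => ?_⟩
  obtain ⟨hY₀, hYu⟩ := hY _ (mem_image_of_mem _ hu)
  refine ⟨hY₀, ?_, hYu⟩
  obtain ⟨p, hp, rfl⟩ := hκ.develops u hu
  have heq := IsDevelopment.eqOn hΓ (continuous_shift u _).continuousOn
    (isDevelopment_iff.2 ⟨_, by simpa [IccExtend_of_mem] using hY₀, hYu⟩) hp
  simpa [IccExtend_of_mem] using heq (right_mem_Icc.2 zero_le_one)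

theorem rnorm_pulledBackForce_le (hκ : IsAdmissible Γ g h x₀ x₁ X₀ ε C W κ)
    (hh : IsRiemannianMetric h) {y : E4} (hG : gravNorm Γ g h y < ε / (ε + C) ^ 2)
    {P : E4 →L[ℝ] E4} (hP : ∀ X, h y (P X) (P X) = h x₀ X X) {u : C(I, E4)}
    (hu : u ∈ curveBall h x₀ ε) (t : ℝ) :
    rnorm h x₀ (pulledBackForce Γ g ((y, P), shift u (κ u) t)) ≤ ε := by
  have hC : 0 ≤ C := (Real.sqrt_nonneg _).trans (hκ.norm_le u hu)
  have hεC : 0 < ε + C := add_pos_of_pos_of_nonneg hκ.eps_pos hC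
  have hG₀ : 0 ≤ ε / (ε + C) ^ 2 := div_nonneg hκ.eps_pos.le (sq_nonneg _)
  calc rnorm h x₀ (pulledBackForce Γ g ((y, P), shift u (κ u) t))
      ≤ gravNorm Γ g h y * rnorm h x₀ (shift u (κ u) t) ^ 2 := hh.rnorm_pulledBackForce_le hP _
    _ ≤ ε / (ε + C) ^ 2 * (ε + C) ^ 2 := by
        gcongr
        · exact Real.sqrt_nonneg _
        · exact hκ.rnorm_shift_le hh hu t
    _ = ε := div_mul_cancel₀ _ (pow_pos hεC 2).ne'

theorem exists_continuousOn_force (hκ : IsAdmissible Γ g h x₀ x₁ X₀ ε C W κ)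
    (hΓ : ContDiff ℝ 1 Γ) (hh : IsRiemannianMetric h) (hΓh : IsMetricConnection Γ h) {O V : Set E4}
    (hO : IsOpen O) (hg : ContDiffOn ℝ 1 g O) (hinv : ∀ x ∈ O, (g x).IsInvertible) (hVO : V ⊆ O)
    (hV : DevelopmentsIn Γ h x₀ ε κ V) :
    ∃ (Y : C(I, E4) → C(I, E4 × (E4 →L[ℝ] E4))) (Φ : C(I, E4) → C(I, E4)),
      ContinuousOn Φ (curveBall h x₀ ε) ∧ ∀ u ∈ curveBall h x₀ ε,
        Y u 0 = (x₀, .id ℝ E4) ∧ (Y u 1).1 = x₁ ∧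
        IsControlledCurve (developmentField Γ) (shift u (κ u)) (IccExtend zero_le_one (Y u)) ∧
        ∀ t : I, (Y u t).1 ∈ V ∧
          (∀ X, h (Y u t).1 ((Y u t).2 X) ((Y u t).2 X) = h x₀ X X) ∧
          Φ u t = pulledBackForce Γ g (Y u t, shift u (κ u) t) := by
  obtain ⟨Y, hYc, hY⟩ := hκ.exists_continuousOn_frame hΓ
  obtain ⟨N, hNc, hN⟩ := exists_continuousOn_comp (α := I)
    (continuousOn_pulledBackForce hΓ.continuous hO hg hinv)
  let control (u : C(I, E4)) : C(I, E4) := u + .const I (κ u)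
  have hcontrol : ContinuousOn control (curveBall h x₀ ε) :=
    continuousOn_id.add (ContinuousMap.continuous_const'.comp_continuousOn hκ.continuousOn)
  have hmem {u} (hu : u ∈ curveBall h x₀ ε) (t : I) : (Y u t).1 ∈ V :=
    hV.frame_mem hu (hY u hu).1 (hY u hu).2.2 t
  have hiso {u} (hu : u ∈ curveBall h x₀ ε) (t : I) :=
    (hY u hu).2.2.isometry hΓh (hh.smooth.differentiable (by simp)) (hY u hu).1 t
  have hdom {u} (hu : u ∈ curveBall h x₀ ε) (t : I) : pairing (control u, Y u) t ∈
      {z : (E4 × (E4 →L[ℝ] E4)) × E4 | z.1.1 ∈ O ∧ z.1.2.IsInvertible} := by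
    rw [pairing_apply]
    exact ⟨hVO (hmem hu t), hh.isInvertible_of_isometry (hiso hu t)⟩
  refine ⟨Y, fun u => N (pairing (control u, Y u)),
    hNc.comp (pairing.continuous.comp_continuousOn (hcontrol.prodMk hYc)) fun u hu => hdom hu,
    fun u hu => ⟨(hY u hu).1, (hY u hu).2.1, (hY u hu).2.2,
      fun t => ⟨hmem hu t, hiso hu t, ?_⟩⟩⟩
  rw [hN _ (hdom hu), pairing_apply]
  simp [control, shift]

theorem exists_hasDerivWithinAt_shift (hκ : IsAdmissible Γ g h x₀ x₁ X₀ ε C W κ)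
    (hΓ : ContDiff ℝ 1 Γ) (hh : IsRiemannianMetric h) (hΓh : IsMetricConnection Γ h) {O V : Set E4}
    (hO : IsOpen O) (hg : ContDiffOn ℝ 1 g O) (hinv : ∀ x ∈ O, (g x).IsInvertible) (hVO : V ⊆ O)
    (hV : DevelopmentsIn Γ h x₀ ε κ V) (hG : ∀ x ∈ V, gravNorm Γ g h x < ε / (ε + C) ^ 2) :
    ∃ u ∈ curveBall h x₀ ε, shift u (κ u) 0 = κ u ∧ ∃ (p : ℝ → E4) (P : ℝ → E4 →L[ℝ] E4),
      (p 0, P 0) = (x₀, .id ℝ E4) ∧ p 1 = x₁ ∧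
      IsControlledCurve (developmentField Γ) (shift u (κ u)) (fun t => (p t, P t)) ∧
      ∀ t ∈ I, p t ∈ O ∧ (P t).IsInvertible ∧ HasDerivWithinAt (shift u (κ u))
        (pulledBackForce Γ g ((p t, P t), shift u (κ u) t)) I t := by
  obtain ⟨Y, Φ, hΦc, hY⟩ := hκ.exists_continuousOn_force hΓ hh hΓh hO hg hinv hVO hV
  obtain ⟨u, hu, hfix⟩ := hh.exists_primitive_eq x₀ hκ.eps_pos.le hΦc fun u hu t => by
    obtain ⟨hmem, hiso, hforce⟩ := (hY u hu).2.2.2 t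
    rw [hforce]
    exact hκ.rnorm_pulledBackForce_le hh (hG _ hmem) hiso hu t
  obtain ⟨hY₀, hY₁, hYu, hforce⟩ := hY u hu
  have hu₀ : u 0 = 0 := by rw [← hfix, primitive_apply_zero]
  have hderiv := eq_const_add_primitive_iff (y := u + .const I (κ u)) (f := Φ u).1 <| by
    simp [hu₀, hfix, add_comm]
  refine ⟨u, hu, by simp [shift, hu₀], fun t => (IccExtend zero_le_one (Y u) t).1,
    fun t => (IccExtend zero_le_one (Y u) t).2, by simpa using hY₀, by simpa using hY₁, hYu,
    fun t ht => ?_⟩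
  obtain ⟨hmem, hiso, hΦ⟩ := hforce ⟨t, ht⟩
  beta_reduce
  rw [IccExtend_of_mem _ _ ht]
  exact ⟨hVO hmem, hh.isInvertible_of_isometry hiso,
    (hderiv t ht).congr_deriv (by rw [IccExtend_of_mem _ _ ht, hΦ])⟩

theorem exists_geodesic (hκ : IsAdmissible Γ g h x₀ x₁ X₀ ε C W κ)
    (hΓ : ContDiff ℝ 1 Γ) (hh : IsRiemannianMetric h) (hΓh : IsMetricConnection Γ h) {O V : Set E4}
    (hO : IsOpen O) (hg : ContDiffOn ℝ 1 g O) (hinv : ∀ x ∈ O, (g x).IsInvertible)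
    (hsymm : ∀ x ∈ O, ∀ X Y, g x X Y = g x Y X) (hVO : V ⊆ O)
    (hV : DevelopmentsIn Γ h x₀ ε κ V) (hG : ∀ x ∈ V, gravNorm Γ g h x < ε / (ε + C) ^ 2) :
    ∃ p q : ℝ → E4, p 0 = x₀ ∧ p 1 = x₁ ∧ ∀ t ∈ I, p t ∈ O ∧
      SolvesGeodesicEq (christoffel g) I p q t ∧ g (p t) (q t) (q t) < 0 := by
  obtain ⟨u, hu, hu₀, p, P, hpP, hp₁, hy, hv⟩ :=
    hκ.exists_hasDerivWithinAt_shift hΓ hh hΓh hO hg hinv hVO hV hG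
  obtain ⟨rfl, hP₀⟩ := Prod.mk.inj hpP
  have hgeodesic (t : ℝ) (ht : t ∈ I) := hy.solvesGeodesicEq ht (hv t ht).2.1 (hv t ht).2.2
  refine ⟨p, _, rfl, hp₁, fun t ht => ⟨(hv t ht).1, hgeodesic t ht, ?_⟩⟩
  have hconst := eqOn_apply_velocity_of_solvesGeodesicEq
    (fun s hs => (hg.contDiffAt (hO.mem_nhds (hv s hs).1)).differentiableAt one_ne_zero)
    (fun s hs => hinv _ (hv s hs).1) (fun s hs => hsymm _ (hv s hs).1) hgeodesic ht
  refine hconst.trans_lt ?_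
  simpa [hP₀, hu₀] using hκ.timelike u hu

end IsAdmissible

end Geodesic

section Reparametrization

variable {a b c : ℝ}

theorem mapsTo_mul_Icc (hc : 0 ≤ c) (hab : c * a = b) :
    MapsTo (fun s => c * s) (Icc 0 a) (Icc 0 b) := fun _ hs =>
  ⟨mul_nonneg hc hs.1, hab ▸ mul_le_mul_of_nonneg_left hs.2 hc⟩

theorem hasDerivWithinAt_comp_mul {X : Type*} [NormedAddCommGroup X] [NormedSpace ℝ X]
    {f : ℝ → X} {f' : X} {J J' : Set ℝ} {t : ℝ} (hf : HasDerivWithinAt f f' J (c * t))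
    (hJ : MapsTo (fun s => c * s) J' J) :
    HasDerivWithinAt (fun s => f (c * s)) (c • f') J' t :=
  hf.scomp t (by simpa using ((hasDerivAt_id t).const_mul c).hasDerivWithinAt) hJ

theorem SolvesGeodesicEq.comp_mul {Γ : E4 → E4 → E4 → E4}
    (hΓ : ∀ x (c : ℝ) X, Γ x (c • X) (c • X) = c ^ 2 • Γ x X X) {J J' : Set ℝ} {y v : ℝ → E4}
    {t : ℝ} (hy : SolvesGeodesicEq Γ J y v (c * t)) (hJ : MapsTo (fun s => c * s) J' J) :
    SolvesGeodesicEq Γ J' (fun s => y (c * s)) (fun s => c • v (c * s)) t := by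
  refine ⟨hasDerivWithinAt_comp_mul hy.1 hJ,
    ((hasDerivWithinAt_comp_mul hy.2 hJ).const_smul c).congr_deriv ?_⟩
  rw [hΓ, smul_neg, smul_neg, smul_smul, sq]

variable {Γ : ConnectionField} {γ γ' : ℝ → E4}

theorem IsFrameGeodesic.comp_mul (hγ : IsFrameGeodesic Γ b γ γ') (hc : 0 ≤ c) (hab : c * a = b) :
    IsFrameGeodesic Γ a (fun t => γ (c * t)) fun t => c • γ' (c * t) := fun _ ht =>
  SolvesGeodesicEq.comp_mul (fun x c X => by simp [smul_smul, sq])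
    (hγ _ (mapsTo_mul_Icc hc hab ht)) (mapsTo_mul_Icc hc hab)

theorem IsJacobiField.comp_mul {J J' : ℝ → E4} (hJ : IsJacobiField Γ b γ γ' J J') (hc : 0 ≤ c)
    (hab : c * a = b) :
    IsJacobiField Γ a (fun t => γ (c * t)) (fun t => c • γ' (c * t)) (fun t => J (c * t))
      fun t => c • J' (c * t) := by
  have hmaps := mapsTo_mul_Icc hc hab
  intro t ht
  obtain ⟨hderiv, hderiv'⟩ := hJ _ (hmaps ht)
  refine ⟨hasDerivWithinAt_comp_mul hderiv hmaps,
    ((hasDerivWithinAt_comp_mul hderiv' hmaps).const_smul c).congr_deriv ?_⟩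
  simp only [map_smul, smul_apply, smul_neg, smul_add]

theorem NotConjugateAlong.comp_mul (hconj : NotConjugateAlong Γ b γ γ') (hc : 0 < c)
    (hab : c * a = b) :
    NotConjugateAlong Γ a (fun t => γ (c * t)) fun t => c • γ' (c * t) := by
  intro J J' hJ hJ₀ hJ₁ t ht
  have hba : c⁻¹ * b = a := by rw [← hab, inv_mul_cancel_left₀ hc.ne']
  have hJac := hJ.comp_mul (inv_nonneg.2 hc.le) hba
  simp only [mul_inv_cancel_left₀ hc.ne', smul_smul, inv_mul_cancel₀ hc.ne', one_smul] at hJac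
  simpa [inv_mul_cancel_left₀ hc.ne'] using hconj _ _ hJac (by simpa using hJ₀)
    (by simpa [hba] using hJ₁) (c * t) (mapsTo_mul_Icc hc.le hab ht)

theorem IsFrameGeodesic.exists_isAdmissible_smul (hΓ : ContDiff ℝ 1 Γ) {g h : FormField}
    (hh : IsRiemannianMetric h) {T : ℝ} (hT : 0 < T) (hγ : IsFrameGeodesic Γ T γ γ')
    (hconj : NotConjugateAlong Γ T γ γ') (hcone : g (γ 0) (γ' 0) (γ' 0) < 0) {U : Set E4}
    (hU : IsOpen U) (hγU : ∀ t ∈ Icc 0 T, γ t ∈ U) :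
    ∃ (ε C : ℝ) (W : Set E4) (κ : C(Icc (0 : ℝ) 1, E4) → E4),
      IsAdmissible Γ g h (γ 0) (γ T) (T • γ' 0) ε C W κ ∧ DevelopmentsIn Γ h (γ 0) ε κ U := by
  have hcone' : g (γ (T * 0)) (T • γ' (T * 0)) (T • γ' (T * 0)) < 0 := by
    simp only [mul_zero, map_smul, smul_apply, smul_eq_mul]
    exact mul_neg_of_pos_of_neg hT (mul_neg_of_pos_of_neg hT hcone)
  simpa using (hγ.comp_mul hT.le (mul_one T)).exists_isAdmissible hΓ hh
    (hconj.comp_mul hT (mul_one T)) hcone' hU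
    fun t ht => hγU _ (mapsTo_mul_Icc hT.le (mul_one T) ht)

end Reparametrization

section LorentzManifold

theorem minkowski_comm (X Y : E4) : minkowski X Y = minkowski Y X := by
  simp only [minkowski, mul_comm]

theorem eq_zero_of_minkowski_eq_zero {X : E4} (hX : ∀ Y, minkowski X Y = 0) : X = 0 := by
  ext i
  have hXi := hX (EuclideanSpace.single i 1)
  fin_cases i <;> simpa [minkowski] using hXi

theorem isInvertible_of_nondegenerate {V : Type*} [NormedAddCommGroup V] [NormedSpace ℝ V]
    [FiniteDimensional ℝ V] {B : V →L[ℝ] V →L[ℝ] ℝ} (hB : ∀ X, (∀ Y, B X Y = 0) → X = 0) :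
    B.IsInvertible := by
  have hrank : Module.finrank ℝ V = Module.finrank ℝ (V →L[ℝ] ℝ) := by
    rw [← (LinearMap.toContinuousLinearMap : (V →ₗ[ℝ] ℝ) ≃ₗ[ℝ] V →L[ℝ] ℝ).finrank_eq]
    exact Subspace.dual_finrank_eq.symm
  exact isInvertible_of_injective hrank <| (injective_iff_map_eq_zero B).2 fun X hX =>
    hB X fun Y => by rw [hX, zero_apply]

theorem mdifferentiable_of_mem_maximalAtlas {𝕜 E H N : Type*} [NontriviallyNormedField 𝕜]
    [NormedAddCommGroup E] [NormedSpace 𝕜 E] [TopologicalSpace H] {I : ModelWithCorners 𝕜 E H}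
    [TopologicalSpace N] [ChartedSpace H N] {n : WithTop ℕ∞} (hn : n ≠ 0)
    {φ : OpenPartialHomeomorph N H} (hφ : φ ∈ IsManifold.maximalAtlas I n N) :
    φ.MDifferentiable I I :=
  ⟨(contMDiffOn_of_mem_maximalAtlas hφ).mdifferentiableOn hn,
    (contMDiffOn_symm_of_mem_maximalAtlas hφ).mdifferentiableOn hn⟩

variable {M : Type*} [TopologicalSpace M] [ChartedSpace E4 M]

namespace LorentzMetric

theorem symm (g : LorentzMetric M) (x : M) (X Y : TangentSpace (𝓡 4) x) :
    g.form x X Y = g.form x Y X := by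
  obtain ⟨b, hb⟩ := g.lorentz x
  obtain ⟨X, rfl⟩ := b.surjective X
  obtain ⟨Y, rfl⟩ := b.surjective Y
  rw [hb, hb, minkowski_comm]

theorem nondegenerate (g : LorentzMetric M) (x : M) {X : TangentSpace (𝓡 4) x}
    (hX : ∀ Y, g.form x X Y = 0) : X = 0 := by
  obtain ⟨b, hb⟩ := g.lorentz x
  obtain ⟨X, rfl⟩ := b.surjective X
  rw [eq_zero_of_minkowski_eq_zero fun Y => (hb X Y).symm.trans (hX (b Y)), map_zero]

variable {φ : OpenPartialHomeomorph M E4}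

theorem isInvertible_formInChart (g : LorentzMetric M)
    (hφ : φ ∈ IsManifold.maximalAtlas (𝓡 4) ∞ M) {y : E4} (hy : y ∈ φ.target) :
    (formInChart g.form φ y).IsInvertible := by
  have hdiff := (mdifferentiable_of_mem_maximalAtlas (by simp) hφ).symm
  refine isInvertible_of_nondegenerate fun X hX => ?_
  have hzero : mfderiv (𝓡 4) (𝓡 4) φ.symm y X = 0 := g.nondegenerate _ fun Z => by
    obtain ⟨Y, rfl⟩ := hdiff.mfderiv_surjective hy Z
    exact hX Y
  exact (injective_iff_map_eq_zero (mfderiv (𝓡 4) (𝓡 4) φ.symm y)).1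
    (hdiff.mfderiv_injective hy) X hzero

variable {T : ℝ} {p q : ℝ → E4}

theorem isLorentzGeodesic_chart_symm (g : LorentzMetric M)
    (hφ : φ ∈ IsManifold.maximalAtlas (𝓡 4) ∞ M) (hpφ : ∀ t ∈ Icc 0 T, p t ∈ φ.target)
    (hp : ∀ t ∈ Icc 0 T, SolvesGeodesicEq (christoffel (formInChart g.form φ)) (Icc 0 T) p q t) :
    IsLorentzGeodesic g T fun t => φ.symm (p t) := by
  have hpc : ContinuousOn p (Icc 0 T) := fun t ht => (hp t ht).1.continuousWithinAt
  have hright : EqOn (fun t => φ (φ.symm (p t))) p (Icc 0 T) :=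
    fun t ht => φ.right_inv (hpφ t ht)
  refine ⟨φ.continuousOn_symm.comp hpc hpφ, fun t₀ ht₀ =>
    ⟨φ, hφ, φ.map_target (hpφ t₀ ht₀), q, ?_⟩⟩
  filter_upwards [self_mem_nhdsWithin] with t ht
  refine ⟨(hp t ht).1.congr hright (hright ht), ?_⟩
  rw [hright ht]
  exact (hp t ht).2

theorem isTimelike_chart_symm (g : LorentzMetric M)
    (hφ : φ ∈ IsManifold.maximalAtlas (𝓡 4) ∞ M) (hT : 0 < T)
    (hpφ : ∀ t ∈ Icc 0 T, p t ∈ φ.target)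
    (hp : ∀ t ∈ Icc 0 T, HasDerivWithinAt p (q t) (Icc 0 T) t)
    (hq : ∀ t ∈ Icc 0 T, formInChart g.form φ (p t) (q t) (q t) < 0) :
    IsTimelike g T fun t => φ.symm (p t) := fun t ht => by
  have hφt := ((mdifferentiable_of_mem_maximalAtlas (by simp) hφ).mdifferentiableAt_symm
    (hpφ t ht)).hasMFDerivAt
  have hderiv := (hφt.comp_hasMFDerivWithinAt t
    (hp t ht).hasFDerivWithinAt.hasMFDerivWithinAt).mfderivWithin
    (uniqueDiffOn_Icc hT t ht).uniqueMDiffWithinAt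
  have hvelocity :
      velocity T (fun t => φ.symm (p t)) t = mfderiv (𝓡 4) (𝓡 4) φ.symm (p t) (q t) := by
    refine (congrArg (fun A : ℝ →L[ℝ] E4 => A 1) hderiv).trans ?_
    exact congrArg (mfderiv (𝓡 4) (𝓡 4) φ.symm (p t)) (one_smul ℝ (q t))
  rw [hvelocity]
  exact hq t ht

end LorentzMetric

theorem IsAdmissible.exists_isLorentzGeodesic (g : LorentzMetric M)
    {φ : OpenPartialHomeomorph M E4} (hφ : φ ∈ IsManifold.maximalAtlas (𝓡 4) ∞ M)
    {Γ : ConnectionField} {h : FormField} {x₀ x₁ X₀ : E4} {ε C : ℝ} {W V : Set E4}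
    {κ : C(Icc (0 : ℝ) 1, E4) → E4}
    (hκ : IsAdmissible Γ (formInChart g.form φ) h x₀ x₁ X₀ ε C W κ) (hΓ : ContDiff ℝ 1 Γ)
    (hh : IsRiemannianMetric h) (hΓh : IsMetricConnection Γ h) (hVφ : V ⊆ φ.target)
    (hV : DevelopmentsIn Γ h x₀ ε κ V)
    (hG : ∀ x ∈ V, gravNorm Γ (formInChart g.form φ) h x < ε / (ε + C) ^ 2)
    {T : ℝ} (hT : 0 < T) :
    ∃ c : ℝ → M, IsLorentzGeodesic g T c ∧ IsTimelike g T c ∧ c 0 = φ.symm x₀ ∧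
      c T = φ.symm x₁ := by
  obtain ⟨p, q, rfl, rfl, hpq⟩ := hκ.exists_geodesic hΓ hh hΓh φ.open_target
    ((g.smooth φ hφ).of_le (by simp)) (fun x hx => g.isInvertible_formInChart hφ hx)
    (fun x _ X Y => g.symm _ _ _) hVφ hV hG
  have hT₁ : T⁻¹ * T = 1 := inv_mul_cancel₀ hT.ne'
  have hmaps := mapsTo_mul_Icc (inv_nonneg.2 hT.le) hT₁
  have hpφ (t) (ht : t ∈ Icc 0 T) : p (T⁻¹ * t) ∈ φ.target := (hpq _ (hmaps ht)).1
  have hgeodesic (t) (ht : t ∈ Icc 0 T) :=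
    (hpq _ (hmaps ht)).2.1.comp_mul christoffel_smul hmaps
  refine ⟨fun t => φ.symm (p (T⁻¹ * t)), g.isLorentzGeodesic_chart_symm hφ hpφ hgeodesic,
    g.isTimelike_chart_symm hφ hT hpφ (fun t ht => (hgeodesic t ht).1) fun t ht => ?_,
    by simp, by simp [hT₁]⟩
  simp only [map_smul, smul_apply, smul_eq_mul]
  exact mul_neg_of_pos_of_neg (inv_pos.2 hT) (mul_neg_of_pos_of_neg (inv_pos.2 hT)
    (hpq _ (hmaps ht)).2.2)

theorem mainTheorem2_general (g : LorentzMetric M) {φ : OpenPartialHomeomorph M E4}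
    (hφ : φ ∈ IsManifold.maximalAtlas (𝓡 4) ∞ M) {h : FormField} (hh : IsRiemannianMetric h)
    {Γ : ConnectionField} (hΓ : ContDiff ℝ 1 Γ) (hΓh : IsMetricConnection Γ h)
    {m₀ m₁ : M} (hm₀ : m₀ ∈ φ.source) (hm₁ : m₁ ∈ φ.source) {T : ℝ} (hT : 0 < T) :
    (∀ γ γ' : ℝ → E4, IsFrameGeodesic Γ T γ γ' → γ 0 = φ m₀ → γ T = φ m₁ →
      NotConjugateAlong Γ T γ γ' → formInChart g.form φ (φ m₀) (γ' 0) (γ' 0) < 0 →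
      ∀ U : Set E4, IsOpen U → (∀ t ∈ Icc 0 T, γ t ∈ U) →
      ∃ (ε C : ℝ) (W : Set E4) (κ : C(Icc (0 : ℝ) 1, E4) → E4),
        IsAdmissible Γ (formInChart g.form φ) h (φ m₀) (φ m₁) (T • γ' 0) ε C W κ ∧
        DevelopmentsIn Γ h (φ m₀) ε κ U) ∧
    ∀ (X₀ : E4) (ε C : ℝ) (W : Set E4) (κ : C(Icc (0 : ℝ) 1, E4) → E4),
      IsAdmissible Γ (formInChart g.form φ) h (φ m₀) (φ m₁) X₀ ε C W κ →
      ∀ V : Set E4, V ⊆ φ.target → DevelopmentsIn Γ h (φ m₀) ε κ V →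
        (∀ x ∈ V, gravNorm Γ (formInChart g.form φ) h x < ε / (ε + C) ^ 2) →
        ∃ c : ℝ → M, IsLorentzGeodesic g T c ∧ IsTimelike g T c ∧ c 0 = m₀ ∧ c T = m₁ := by
  refine ⟨fun γ γ' hγ hγ₀ hγ₁ hconj hcone U hU hγU => ?_, fun X₀ ε C W κ hκ V hVφ hV hG => ?_⟩
  · rw [← hγ₀] at hcone ⊢
    rw [← hγ₁]
    exact hγ.exists_isAdmissible_smul hΓ hh hT hconj hcone hU hγU
  · simpa only [φ.left_inv hm₀, φ.left_inv hm₁] using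
      hκ.exists_isLorentzGeodesic g hφ hΓ hh hΓh hVφ hV hG hT

end LorentzManifold

theorem mainTheorem2 {M : Type*} [TopologicalSpace M] [T2Space M] [ChartedSpace E4 M]
    [IsManifold (𝓡 4) ∞ M] (g : LorentzMetric M) (F : ReferenceFrame g)
    (h : FormField) (hh : IsRiemannianMetric h)
    (Γ : ConnectionField) (hΓ : ContDiff ℝ ∞ Γ) (hΓh : IsMetricConnection Γ h)
    (m₀ m₁ : M) (hm₀ : m₀ ∈ F.chart.source) (hm₁ : m₁ ∈ F.chart.source)
    (T : ℝ) (hT : 0 < T) (γ γ' : ℝ → E4) (hγ : IsFrameGeodesic Γ T γ γ')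
    (hγO : ∀ t ∈ Icc 0 T, γ t ∈ F.chart.target)
    (hγ₀ : γ 0 = F.chart m₀) (hγ₁ : γ T = F.chart m₁)
    (hconj : NotConjugateAlong Γ T γ γ')
    (hcone : F.metric (F.chart m₀) (γ' 0) (γ' 0) < 0) :
    (∀ U : Set E4, IsOpen U → (∀ t ∈ Icc 0 T, γ t ∈ U) →
      ∃ (ε C : ℝ) (W : Set E4) (κ : C(Icc (0 : ℝ) 1, E4) → E4),
        IsAdmissible Γ F.metric h (F.chart m₀) (F.chart m₁) (T • γ' 0) ε C W κ ∧
        DevelopmentsIn Γ h (F.chart m₀) ε κ U) ∧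
    ∀ (ε C : ℝ) (W : Set E4) (κ : C(Icc (0 : ℝ) 1, E4) → E4),
      IsAdmissible Γ F.metric h (F.chart m₀) (F.chart m₁) (T • γ' 0) ε C W κ →
      ∀ V : Set E4, V ⊆ F.chart.target → DevelopmentsIn Γ h (F.chart m₀) ε κ V →
        (∀ x ∈ V, gravNorm Γ F.metric h x < ε / (ε + C) ^ 2) →
        ∃ c : ℝ → M, IsLorentzGeodesic g T c ∧ IsTimelike g T c ∧ c 0 = m₀ ∧ c T = m₁ := by
  have general := mainTheorem2_general g F.chart_mem hh (hΓ.of_le (by simp)) hΓh hm₀ hm₁ hT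
  exact ⟨general.1 γ γ' hγ hγ₀ hγ₁ hconj hcone, general.2 (T • γ' 0)⟩
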